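/- All graphs are finite, simple and undirected. For a connected graph $G=(V,E)$, a spanning tree $T$ of $G$ and an edge $e\in E(T)$, the congestion of $e$ is the number of edges $\{u,v\}\in E$ such that $e$ lies on the unique $u$–$v$ path in $T$; the congestion of $T$ is the maximum congestion of its edges ($0$ if $T$ has no edge), and the spanning tree congestion $\mathrm{stc}(G)$ is the minimum congestion over all spanning trees of $G$. Theorem. There is an algorithm that, given a connected graph $G=(V,E)$ with $n=|V|$ and a set $S\subseteq V$ with $q=|S|$ such that $G-S$ is a clique (any two distinct vertices of $V\setminus S$ are adjacent), returns a spanning tree of $G$ of congestion $\mathrm{stc}(G)$ in time $2^{O(q^3)}\,n^{O(1)}$; that is, there is a constant $c$ such that on every such input the algorithm halts within $c\cdot 2^{c q^3}\cdot n^{c}$ steps. Here an algorithm is a fixed program of a random access machine whose unit-cost instructions are addition, (truncated) subtraction, tests for zero and indirect memory access on natural numbers; $G$ and $T$ are represented by adjacency matrices and $S$ by its characteristic vector. -/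

import Mathlib

/-! ### Spanning tree congestion -/

namespace STC

variable {V : Type*}

/-- `T` is a spanning tree of `G` (both on the vertex set `V`). -/
def IsSpanningTree (G T : SimpleGraph V) : Prop :=
  T ≤ G ∧ T.IsTree

/-- The edge `e` lies on the detour of `f = {u, v}` in the tree `T`, i.e. on the (unique)
`u`-`v` path in `T`. -/
def OnDetour (T : SimpleGraph V) (f e : Sym2 V) : Prop :=
  ∃ (u v : V) (p : T.Walk u v), f = s(u, v) ∧ p.IsPath ∧ e ∈ p.edges

/-- The congestion of `e`: the number of edges of `G` whose detours in `T` contain `e`. -/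
noncomputable def edgeCongestion (G T : SimpleGraph V) (e : Sym2 V) : ℕ :=
  {f : Sym2 V | f ∈ G.edgeSet ∧ OnDetour T f e}.ncard

/-- The congestion of `T`: the maximum congestion of its edges (`0` if `T` has no edge). -/
noncomputable def treeCongestion (G T : SimpleGraph V) : ℕ :=
  ⨆ e : T.edgeSet, edgeCongestion G T e

/-- The spanning tree congestion of `G`: the minimum congestion of its spanning trees. -/
noncomputable def stc (G : SimpleGraph V) : ℕ :=
  sInf {k : ℕ | ∃ T : SimpleGraph V, IsSpanningTree G T ∧ treeCongestion G T = k}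

end STC

/-! ### Random access machine programs with unit cost

Programs use finitely many natural-number variables and finitely many arrays with indirect
addressing. The arithmetic is addition and truncated subtraction only (no multiplication), so
that the numbers in a run of `t` steps have `O(t)` more bits than the input, and the
number of steps is polynomially related to the running time of a Turing machine. -/

namespace RAM

/-- Expressions; every occurrence of a symbol costs one step. -/
inductive Exp : Type
  | const (c : ℕ)
  | var (x : ℕ)
  | add (e₁ e₂ : Exp)
  | sub (e₁ e₂ : Exp)
  | get (a : ℕ) (e : Exp)

/-- Programs: assignment to a variable, storing into an array, sequence, branching and loops
(a condition is true when it is nonzero). -/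
inductive Prog : Type
  | skip
  | assign (x : ℕ) (e : Exp)
  | store (a : ℕ) (i e : Exp)
  | seq (p₁ p₂ : Prog)
  | ite (b : Exp) (p₁ p₂ : Prog)
  | while (b : Exp) (p : Prog)

/-- The contents of the variables and of the arrays. -/
@[ext]
structure State : Type where
  var : ℕ → ℕ
  arr : ℕ → ℕ → ℕ

def Exp.eval (s : State) : Exp → ℕ
  | .const c => c
  | .var x => s.var x
  | .add e₁ e₂ => e₁.eval s + e₂.eval s
  | .sub e₁ e₂ => e₁.eval s - e₂.eval s
  | .get a e => s.arr a (e.eval s)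

/-- The number of steps needed to evaluate an expression. -/
def Exp.cost : Exp → ℕ
  | .const _ => 1
  | .var _ => 1
  | .add e₁ e₂ => e₁.cost + e₂.cost + 1
  | .sub e₁ e₂ => e₁.cost + e₂.cost + 1
  | .get _ e => e.cost + 1

def State.setVar (s : State) (x v : ℕ) : State :=
  { s with var := Function.update s.var x v }

def State.setArr (s : State) (a i v : ℕ) : State :=
  { s with arr := Function.update s.arr a (Function.update (s.arr a) i v) }

/-- `Exec p s t s'`: started in state `s`, the program `p` halts after exactly `t` steps
in state `s'`. -/
inductive Exec : Prog → State → ℕ → State → Prop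
  | skip (s : State) : Exec .skip s 1 s
  | assign (x : ℕ) (e : Exp) (s : State) :
      Exec (.assign x e) s (e.cost + 1) (s.setVar x (e.eval s))
  | store (a : ℕ) (i e : Exp) (s : State) :
      Exec (.store a i e) s (i.cost + e.cost + 1) (s.setArr a (i.eval s) (e.eval s))
  | seq {p₁ p₂ : Prog} {s s₁ s₂ : State} {t₁ t₂ : ℕ} :
      Exec p₁ s t₁ s₁ → Exec p₂ s₁ t₂ s₂ → Exec (.seq p₁ p₂) s (t₁ + t₂) s₂
  | ite_true {b : Exp} {p₁ p₂ : Prog} {s s' : State} {t : ℕ} :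
      b.eval s ≠ 0 → Exec p₁ s t s' → Exec (.ite b p₁ p₂) s (b.cost + 1 + t) s'
  | ite_false {b : Exp} {p₁ p₂ : Prog} {s s' : State} {t : ℕ} :
      b.eval s = 0 → Exec p₂ s t s' → Exec (.ite b p₁ p₂) s (b.cost + 1 + t) s'
  | while_false {b : Exp} {p : Prog} {s : State} :
      b.eval s = 0 → Exec (.while b p) s (b.cost + 1) s
  | while_true {b : Exp} {p : Prog} {s s₁ s₂ : State} {t₁ t₂ : ℕ} :
      b.eval s ≠ 0 → Exec p s t₁ s₁ → Exec (.while b p) s₁ t₂ s₂ →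
      Exec (.while b p) s (b.cost + 1 + t₁ + t₂) s₂

end RAM

/-! ### Encoding of graphs -/

namespace STC

open Classical in
/-- The adjacency matrix of `G`, row by row: cell `n * u + v` holds `1` if `u` and `v` are
adjacent; all other cells hold `0`. -/
noncomputable def adjArray {n : ℕ} (G : SimpleGraph (Fin n)) (i : ℕ) : ℕ :=
  if ∃ u v : Fin n, i = n * (u : ℕ) + (v : ℕ) ∧ G.Adj u v then 1 else 0

open Classical in
/-- The characteristic vector of `S`. -/
noncomputable def setArray {n : ℕ} (S : Finset (Fin n)) (i : ℕ) : ℕ :=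
  if ∃ v ∈ S, i = (v : ℕ) then 1 else 0

/-- The initial state on input `(G, S)`: variable `0` holds `n`, array `0` holds the
adjacency matrix of `G`, array `1` the characteristic vector of `S`, and everything else
is `0`. -/
noncomputable def inputState {n : ℕ} (G : SimpleGraph (Fin n)) (S : Finset (Fin n)) :
    RAM.State where
  var x := if x = 0 then n else 0
  arr a := if a = 0 then adjArray G else if a = 1 then setArray S else fun _ => 0

/-- A final state returns the graph `T` if array `2` holds the adjacency matrix of `T` in its
first `n * n` cells. -/
def Returns {n : ℕ} (s : RAM.State) (T : SimpleGraph (Fin n)) : Prop :=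
  ∀ i < n * n, s.arr 2 i = adjArray T i

end STC

/-!
The graph consists of a clique `K`, of `m` vertices, and of a set `S` of `q` further vertices. In a
rooted spanning tree, the congestion of the edge above a vertex `v` is the number of edges of the
graph between the descendants of `v` and the other vertices (`IsParentMap.edgeCongestion_eq`).

The algorithm is an exhaustive search over short descriptions of rooted trees: a root, a default
parent `hub`, and a list of `O(q ^ 2)` vertices with their parents, all other vertices being
children of `hub`. That some optimal tree has such a description (`exists_short_description`) is clear if
`m = O(q ^ 2)`. Otherwise there is a spanning tree of congestion less than `2 * (m - 2)`
(`stc_le_of_large_clique`), so that no edge of an optimal tree has two vertices of `K` on each of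
its sides. Hence there is a vertex `hub` such that at most one vertex of `K` is not below it, and such
that the subtrees hanging from `hub` contain at most one vertex of `K` each. A vertex of `K` in such
a subtree which is not a child of `hub` has its parent in `S`, and different ones have different
parents; so there are at most `q` of them.

For the tree of congestion less than `2 * (m - 2)`, the root `a` is a vertex of `K`, and the other
vertices of `K` are its children, as are the neighbours of `a` in `S`. The other vertices of `S`
which have neighbours in `K` are made children of such neighbours, separately if they have many of
them, and the remaining vertices of `S` are hung on the others. The critical edges are those above a
vertex of `K` with a child `s` in `S` that is adjacent to almost all of `K`; an averaging argument
provides a root `a` for which the number of such `s` is small compared to the number of vertices of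
`K` they are not adjacent to (`exists_center`).

Vertices of `K` with the same neighbours in `S` are exchanged by automorphisms, so that only
`O(q ^ 2)` vertices of each of the at most `2 ^ q` classes have to be considered as roots, hubs and
entries of the list (`exists_automorphism`). This leaves
`(2 ^ q * O(q ^ 2) + q) ^ O(q ^ 2) = 2 ^ O(q ^ 3)` descriptions (`bound_le`).

The program is not written down explicitly. The functions `Comp` of a valuation of local variables,
those computed by a machine program in time polynomial in a given bound on the numbers of rounds of
loops, are closed under machine arithmetic, case distinction and bounded iteration (`Comp.iter`).
So it suffices to define the search by these means; sharing of intermediate results is unnecessary,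
since the degree of the polynomial is irrelevant.
-/

/-! ### Functions computable in polynomial time relative to a bound -/

namespace RAM

/-- A context for open terms over a type `β` of valuations: `inp b` is the initial state of the
machine (only its variable `0` and its arrays `0` and `1` are referred to), `env i b` is the value
of the local variable with de Bruijn index `i`, and `dom` restricts the valuations considered. -/
structure Ctx (β : Type) where
  inp : β → State
  env : ℕ → β → ℕ
  dom : β → Prop

/-- The state `s` represents the valuation `b`, the local variable `i` being stored in the machine
variable `loc i`. -/
def Ctx.Matches {β : Type} (Γ : Ctx β) (loc : ℕ → ℕ) (b : β) (s : State) : Prop :=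
  s.var 0 = (Γ.inp b).var 0 ∧ s.arr 0 = (Γ.inp b).arr 0 ∧ s.arr 1 = (Γ.inp b).arr 1 ∧
    ∀ i, s.var (loc i) = Γ.env i b

/-- `f` is computed, in time polynomial in `bd`, by a program which writes no array and, of the
variables, only those from `M` on, and which leaves its result in `M`. The bound `M` above the
live variables is arbitrary, so that the program can be run while other values are stored. -/
def Comp (bd : State → ℕ) {β : Type} (Γ : Ctx β) (f : β → ℕ) : Prop :=
  ∀ (loc : ℕ → ℕ) (M : ℕ), 0 < M → (∀ i, loc i < M) → ∃ (p : Prog) (K : ℕ),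
    ∀ b, Γ.dom b → ∀ s, Γ.Matches loc b s → ∃ t s', Exec p s t s' ∧
      t ≤ K * (bd (Γ.inp b) + 1) ^ K ∧ s'.arr = s.arr ∧ (∀ i < M, s'.var i = s.var i) ∧
      s'.var M = f b

theorem Ctx.Matches.of_agree {β : Type} {Γ : Ctx β} {loc : ℕ → ℕ} {b : β} {s s' : State} {M : ℕ}
    (h : Γ.Matches loc b s) (hM : 0 < M) (hl : ∀ i, loc i < M) (ha : s'.arr = s.arr)
    (hv : ∀ i < M, s'.var i = s.var i) : Γ.Matches loc b s' := by
  obtain ⟨h1, h2, h3, h4⟩ := h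
  exact ⟨by rw [hv 0 hM, h1], by rw [ha, h2], by rw [ha, h3], fun i => by rw [hv _ (hl i), h4]⟩

theorem poly_le {X K K' : ℕ} (hK : K ≤ K') : K * (X + 1) ^ K ≤ K' * (X + 1) ^ K' :=
  Nat.mul_le_mul hK (Nat.pow_le_pow_right (Nat.succ_pos X) hK)

theorem le_poly {X K c : ℕ} (hc : c ≤ K) : c ≤ K * (X + 1) ^ K :=
  hc.trans (Nat.le_mul_of_pos_right _ (by positivity))

/-- Sums of polynomial bounds are polynomial bounds. -/
theorem poly_add {X K₁ K₂ c t₁ t₂ : ℕ} (h₁ : t₁ ≤ K₁ * (X + 1) ^ K₁)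
    (h₂ : t₂ ≤ K₂ * (X + 1) ^ K₂) : t₁ + t₂ + c ≤ (K₁ + K₂ + c) * (X + 1) ^ (K₁ + K₂ + c) := by
  have e₁ : (X + 1) ^ K₁ ≤ (X + 1) ^ (K₁ + K₂ + c) :=
    Nat.pow_le_pow_right (Nat.succ_pos X) (by omega)
  have e₂ : (X + 1) ^ K₂ ≤ (X + 1) ^ (K₁ + K₂ + c) :=
    Nat.pow_le_pow_right (Nat.succ_pos X) (by omega)
  have e₃ : 1 ≤ (X + 1) ^ (K₁ + K₂ + c) := Nat.one_le_pow _ _ (Nat.succ_pos X)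
  have := Nat.mul_le_mul_left K₁ e₁
  have := Nat.mul_le_mul_left K₂ e₂
  have := Nat.mul_le_mul_left c e₃
  rw [add_mul, add_mul]
  omega

theorem poly_mul {X K₁ n t : ℕ} (hn : n ≤ X) (h₁ : t ≤ K₁ * (X + 1) ^ K₁) :
    n * t ≤ (K₁ + 1) * (X + 1) ^ (K₁ + 1) := by
  calc n * t ≤ (X + 1) * ((K₁ + 1) * (X + 1) ^ K₁) := by
        gcongr
        · omega
        · exact h₁.trans (Nat.mul_le_mul_right _ (by omega))
    _ = _ := by ring

variable {β : Type} {bd : State → ℕ} {Γ : Ctx β} {f g h : β → ℕ}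

theorem Comp.congr (hf : Comp bd Γ f) (e : ∀ b, Γ.dom b → f b = g b) : Comp bd Γ g := by
  intro loc M hM hl
  obtain ⟨p, K, H⟩ := hf loc M hM hl
  refine ⟨p, K, fun b hb s hs => ?_⟩
  rw [← e b hb]
  exact H b hb s hs

/-- The value of an expression that reads only live variables. -/
theorem Comp.of_exp
    (H : ∀ loc : ℕ → ℕ, ∃ e : Exp, ∀ b, Γ.dom b → ∀ s, Γ.Matches loc b s → e.eval s = f b) :
    Comp bd Γ f := by
  intro loc M hM hl
  obtain ⟨e, he⟩ := H loc
  refine ⟨.assign M e, e.cost + 1, fun b hb s hs => ⟨_, _, Exec.assign M e s, le_poly le_rfl,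
    rfl, ?_, ?_⟩⟩
  · intro i hi
    simp [State.setVar, Function.update, hi.ne]
  · simp [State.setVar, he b hb s hs]

theorem Comp.const (c : ℕ) : Comp bd Γ fun _ => c :=
  .of_exp fun _ => ⟨.const c, fun _ _ _ _ => rfl⟩

theorem Comp.size : Comp bd Γ fun b => (Γ.inp b).var 0 :=
  .of_exp fun _ => ⟨.var 0, fun _ _ _ hs => hs.1⟩

theorem Comp.slot (i : ℕ) : Comp bd Γ fun b => Γ.env i b :=
  .of_exp fun loc => ⟨.var (loc i), fun _ _ _ hs => hs.2.2.2 i⟩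

/-- Composition with a machine expression in one argument. -/
theorem Comp.exp₁ (hf : Comp bd Γ f) (e : ℕ → Exp) (c : ℕ) (hc : ∀ x, (e x).cost = c)
    (he : ∀ M b s, s.arr 0 = (Γ.inp b).arr 0 → s.arr 1 = (Γ.inp b).arr 1 → s.var M = f b →
      (e M).eval s = g b) : Comp bd Γ g := by
  intro loc M hM hl
  obtain ⟨p, K, H⟩ := hf loc M hM hl
  refine ⟨.seq p (.assign M (e M)), K + 0 + (c + 1), fun b hb s hs => ?_⟩
  obtain ⟨t, s', h1, h2, h3, h4, h5⟩ := H b hb s hs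
  refine ⟨_, _, .seq h1 (.assign M (e M) s'), ?_, h3, ?_, ?_⟩
  · rw [hc]
    have := poly_add (X := bd (Γ.inp b)) (c := c + 1) h2 (K₂ := 0) (t₂ := 0) (by simp)
    omega
  · intro i hi
    simp [State.setVar, Function.update, hi.ne, h4 i hi]
  · simp [State.setVar, he M b s' (by rw [h3, hs.2.1]) (by rw [h3, hs.2.2.1]) h5]

/-- Composition with a machine expression in two arguments. -/
theorem Comp.exp₂ (hf : Comp bd Γ f) (hg : Comp bd Γ g) (e : ℕ → ℕ → Exp) (c : ℕ)
    (hc : ∀ x y, (e x y).cost = c)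
    (he : ∀ x y b s, s.var x = f b → s.var y = g b → (e x y).eval s = h b) : Comp bd Γ h := by
  intro loc M hM hl
  obtain ⟨p, K, H⟩ := hf loc M hM hl
  obtain ⟨p', K', H'⟩ := hg loc (M + 1) (by omega) (fun i => (hl i).trans (by omega))
  refine ⟨.seq (.seq p p') (.assign M (e M (M + 1))), K + K' + (c + 1), fun b hb s hs => ?_⟩
  obtain ⟨t, s', h1, h2, h3, h4, h5⟩ := H b hb s hs
  obtain ⟨t', s'', h1', h2', h3', h4', h5'⟩ := H' b hb s' (hs.of_agree hM hl h3 h4)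
  refine ⟨_, _, .seq (.seq h1 h1') (.assign M (e M (M + 1)) s''), ?_, h3'.trans h3, ?_, ?_⟩
  · rw [hc]
    exact poly_add h2 h2'
  · intro i hi
    simp [State.setVar, Function.update, hi.ne, h4 i hi, h4' i (by omega)]
  · simp [State.setVar, he M (M + 1) b s'' (by rw [h4' M (by omega), h5]) h5']

theorem Comp.add (hf : Comp bd Γ f) (hg : Comp bd Γ g) : Comp bd Γ fun b => f b + g b :=
  hf.exp₂ hg (fun x y => .add (.var x) (.var y)) 3 (fun _ _ => rfl)
    fun x y b s h1 h2 => by simp [Exp.eval, h1, h2]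

theorem Comp.sub (hf : Comp bd Γ f) (hg : Comp bd Γ g) : Comp bd Γ fun b => f b - g b :=
  hf.exp₂ hg (fun x y => .sub (.var x) (.var y)) 3 (fun _ _ => rfl)
    fun x y b s h1 h2 => by simp [Exp.eval, h1, h2]

/-- Access to the adjacency matrix. -/
theorem Comp.get₀ (hf : Comp bd Γ f) : Comp bd Γ fun b => (Γ.inp b).arr 0 (f b) :=
  hf.exp₁ (fun x => .get 0 (.var x)) 2 (fun _ => rfl)
    fun x b s h1 _ h3 => by simp [Exp.eval, h1, h3]

/-- Access to the characteristic vector. -/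
theorem Comp.get₁ (hf : Comp bd Γ f) : Comp bd Γ fun b => (Γ.inp b).arr 1 (f b) :=
  hf.exp₁ (fun x => .get 1 (.var x)) 2 (fun _ => rfl)
    fun x b s _ h2 h3 => by simp [Exp.eval, h2, h3]

/-- Predicates whose characteristic function is computable. -/
def CompP (bd : State → ℕ) {β : Type} (Γ : Ctx β) (P : β → Prop) : Prop :=
  ∃ f : β → ℕ, Comp bd Γ f ∧ ∀ b, Γ.dom b → (f b ≠ 0 ↔ P b)

theorem Comp.ite {P : β → Prop} [∀ b, Decidable (P b)] (hP : CompP bd Γ P) (hf : Comp bd Γ f)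
    (hg : Comp bd Γ g) : Comp bd Γ fun b => if P b then f b else g b := by
  obtain ⟨k, hk, hkP⟩ := hP
  intro loc M hM hl
  obtain ⟨p, K, H⟩ := hk loc M hM hl
  obtain ⟨p₁, K₁, H₁⟩ := hf loc M hM hl
  obtain ⟨p₂, K₂, H₂⟩ := hg loc M hM hl
  refine ⟨.seq p (.ite (.var M) p₁ p₂), K + (K₁ + K₂) + 2, fun b hb s hs => ?_⟩
  obtain ⟨t, s', h1, h2, h3, h4, h5⟩ := H b hb s hs
  by_cases hPb : P b
  · obtain ⟨t', s'', h1', h2', h3', h4', h5'⟩ := H₁ b hb s' (hs.of_agree hM hl h3 h4)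
    have h0 : (Exp.var M).eval s' ≠ 0 := by
      change s'.var M ≠ 0
      rw [h5]
      exact (hkP b hb).2 hPb
    refine ⟨_, _, .seq h1 (.ite_true h0 h1'), ?_, h3'.trans h3,
      fun i hi => (h4' i hi).trans (h4 i hi), by simp [h5', hPb]⟩
    have := poly_add (c := 2) h2 (h2'.trans (poly_le (Nat.le_add_right K₁ K₂)))
    simp only [Exp.cost]
    omega
  · obtain ⟨t', s'', h1', h2', h3', h4', h5'⟩ := H₂ b hb s' (hs.of_agree hM hl h3 h4)
    have h0 : (Exp.var M).eval s' = 0 := by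
      change s'.var M = 0
      rw [h5]
      exact not_not.1 (mt (hkP b hb).1 hPb)
    refine ⟨_, _, .seq h1 (.ite_false h0 h1'), ?_, h3'.trans h3,
      fun i hi => (h4' i hi).trans (h4 i hi), by simp [h5', hPb]⟩
    have := poly_add (c := 2) h2 (h2'.trans (poly_le (Nat.le_add_left K₂ K₁)))
    simp only [Exp.cost]
    omega

/-- The context of the body of a loop with `cnt b` rounds: a valuation `(b, i, x)` consists of one
of `Γ`, the number of the round and the value accumulated so far. -/
def Ctx.loop (Γ : Ctx β) (cnt : β → ℕ) : Ctx (β × ℕ × ℕ) where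
  inp b := Γ.inp b.1
  env
    | 0, b => b.2.2
    | 1, b => b.2.1
    | i + 2, b => Γ.env i b.1
  dom b := Γ.dom b.1 ∧ b.2.1 < cnt b.1

/-- A term may be used inside of a loop. -/
theorem Comp.weaken (hf : Comp bd Γ f) (cnt : β → ℕ) :
    Comp bd (Γ.loop cnt) fun b => f b.1 := by
  intro loc M hM hl
  obtain ⟨p, K, H⟩ := hf (fun i => loc (i + 2)) M hM (fun i => hl _)
  exact ⟨p, K, fun b hb s hs => H b.1 hb.1 s ⟨hs.1, hs.2.1, hs.2.2.1, fun i => hs.2.2.2 (i + 2)⟩⟩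

theorem Comp.index {cnt : β → ℕ} : Comp bd (Γ.loop cnt) fun b => b.2.1 :=
  Comp.slot (Γ := Γ.loop cnt) 1

theorem Comp.acc {cnt : β → ℕ} : Comp bd (Γ.loop cnt) fun b => b.2.2 :=
  Comp.slot (Γ := Γ.loop cnt) 0

/-- The value accumulated by `k` rounds of a loop. -/
def iter (x : ℕ) (F : ℕ → ℕ → ℕ) : ℕ → ℕ
  | 0 => x
  | k + 1 => F k (iter x F k)

/-- The locations of the local variables in the body of a loop. -/
def loopLoc (loc : ℕ → ℕ) (M : ℕ) : ℕ → ℕ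
  | 0 => M
  | 1 => M + 1
  | i + 2 => loc i

/-- Bounded iteration preserves computability if the number of rounds is at most the bound. -/
theorem Comp.iter {cnt init : β → ℕ} {body : β × ℕ × ℕ → ℕ} (hc : Comp bd Γ cnt)
    (hi : Comp bd Γ init) (hb : Comp bd (Γ.loop cnt) body)
    (hle : ∀ b, Γ.dom b → cnt b ≤ bd (Γ.inp b)) :
    Comp bd Γ fun b => RAM.iter (init b) (fun i x => body (b, i, x)) (cnt b) := by
  intro loc M hM hl
  obtain ⟨pc, Kc, Hc⟩ := hc loc (M + 2) (by omega) (fun i => (hl i).trans (by omega))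
  obtain ⟨pi, Ki, Hi⟩ := hi loc (M + 3) (by omega) (fun i => (hl i).trans (by omega))
  obtain ⟨pb, Kb, Hb⟩ := hb (loopLoc loc M) (M + 3) (by omega) (by
    rintro (_ | _ | i)
    · simp [loopLoc]
    · simp [loopLoc]
    · exact (hl i).trans (by omega))
  let step : Prog := .seq pb (.seq (.assign M (.var (M + 3)))
    (.assign (M + 1) (.add (.var (M + 1)) (.const 1))))
  let cond : Exp := .sub (.var (M + 2)) (.var (M + 1))
  let W : Prog := .while cond step
  refine ⟨.seq (.seq pc pi) (.seq (.assign M (.var (M + 3))) (.seq (.assign (M + 1) (.const 0)) W)),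
    (Kc + Ki + 0) + (Kb + 0 + 10 + 1) + 8, fun b hdb s hs => ?_⟩
  obtain ⟨t, s', h1, h2, h3, h4, h5⟩ := Hc b hdb s hs
  obtain ⟨t', s'', h1', h2', h3', h4', h5'⟩ := Hi b hdb s'
    (hs.of_agree (M := M + 2) (by omega) (fun i => (hl i).trans (by omega)) h3 h4)
  set R := fun k => RAM.iter (init b) (fun i x => body (b, i, x)) k with hR
  -- The loop, started in round `cnt b - k`, performs the remaining `k` rounds.
  have key : ∀ k ≤ cnt b, ∀ u : State, u.arr = s.arr → (∀ i < M, u.var i = s.var i) →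
      u.var M = R (cnt b - k) → u.var (M + 1) = cnt b - k → u.var (M + 2) = cnt b →
      ∃ T u', Exec W u T u' ∧ T ≤ k * (Kb * (bd (Γ.inp b) + 1) ^ Kb + 10) + 4 ∧
        u'.arr = s.arr ∧ (∀ i < M, u'.var i = s.var i) ∧ u'.var M = R (cnt b) := by
    intro k
    induction k with
    | zero =>
      intro _ u ha hv h0 h1 h2
      refine ⟨_, u, .while_false ?_, ?_, ha, hv, h0⟩
      · simp [cond, Exp.eval, h1, h2]
      · simp [cond, Exp.cost]
    | succ k ih =>
      intro hk u ha hv h0 h1 h2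
      have hm : (Γ.loop cnt).Matches (loopLoc loc M)
          (b, cnt b - (k + 1), R (cnt b - (k + 1))) u := by
        refine ⟨?_, ?_, ?_, ?_⟩
        · change u.var 0 = (Γ.inp b).var 0
          rw [hv 0 hM, hs.1]
        · change u.arr 0 = (Γ.inp b).arr 0
          rw [ha, hs.2.1]
        · change u.arr 1 = (Γ.inp b).arr 1
          rw [ha, hs.2.2.1]
        · rintro (_ | _ | i)
          · exact h0
          · exact h1
          · change u.var (loc i) = Γ.env i b
            rw [hv _ (hl i), hs.2.2.2]
      obtain ⟨tb, v, e1, e2, e3, e4, e5⟩ := Hb (b, cnt b - (k + 1), R (cnt b - (k + 1)))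
        ⟨hdb, by change cnt b - (k + 1) < cnt b; omega⟩ u hm
      let v₁ := v.setVar M (v.var (M + 3))
      let v₂ := v₁.setVar (M + 1) (v₁.var (M + 1) + 1)
      have hstep : Exec step u (tb + (2 + 4)) v₂ :=
        .seq e1 (.seq (.assign _ _ _) (.assign _ _ _))
      obtain ⟨T, u', g1, g2, g3, g4, g5⟩ := ih (by omega) v₂ (e3.trans ha)
        (by
          intro i hi
          have : v₂.var i = v.var i := by
            simp [v₂, v₁, State.setVar, Function.update, hi.ne, show i ≠ M + 1 by omega]
          rw [this, e4 i (by omega), hv i hi])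
        (by
          have : v₂.var M = v.var (M + 3) := by
            simp [v₂, v₁, State.setVar]
          rw [this, e5, show cnt b - k = cnt b - (k + 1) + 1 by omega]
          rfl)
        (by
          have : v₂.var (M + 1) = v.var (M + 1) + 1 := by
            simp [v₂, v₁, State.setVar]
          rw [this, e4 (M + 1) (by omega), h1]
          omega)
        (by
          have : v₂.var (M + 2) = v.var (M + 2) := by
            simp [v₂, v₁, State.setVar, Function.update]
          rw [this, e4 (M + 2) (by omega), h2])
      have hcond : cond.eval u ≠ 0 := by
        simp only [cond, Exp.eval, h1, h2]
        omega
      refine ⟨_, u', .while_true hcond hstep g1, ?_, g3, g4, g5⟩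
      have e2' : tb ≤ Kb * (bd (Γ.inp b) + 1) ^ Kb := e2
      simp only [cond, Exp.cost]
      rw [add_mul]
      omega
  let v₁ := s''.setVar M (s''.var (M + 3))
  let v₂ := v₁.setVar (M + 1) 0
  have hv : ∀ i < M, v₂.var i = s.var i := by
    intro i hi
    have : v₂.var i = s''.var i := by
      simp [v₂, v₁, State.setVar, Function.update, hi.ne, show i ≠ M + 1 by omega]
    rw [this, h4' i (by omega), h4 i (by omega)]
  obtain ⟨T, u', g1, g2, g3, g4, g5⟩ := key (cnt b) le_rfl v₂ (h3'.trans h3) hv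
    (by
      have : v₂.var M = s''.var (M + 3) := by simp [v₂, v₁, State.setVar]
      rw [this, h5', Nat.sub_self]
      rfl)
    (by simp [v₂, State.setVar])
    (by
      have : v₂.var (M + 2) = s''.var (M + 2) := by
        simp [v₂, v₁, State.setVar, Function.update]
      rw [this, h4' _ (by omega), h5])
  refine ⟨_, u', .seq (.seq h1 h1') (.seq (.assign _ _ _) (.seq (.assign _ _ _) g1)), ?_,
    g3, g4, g5⟩
  have b1 := poly_add (c := 0) h2 h2'
  have b2 := poly_mul (hle b hdb)
    (poly_add (X := bd (Γ.inp b)) (c := 10) (le_refl (Kb * (bd (Γ.inp b) + 1) ^ Kb))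
      (K₂ := 0) (t₂ := 0) (by simp))
  have b3 := poly_add (c := 8) b1 b2
  simp only [Exp.cost]
  simp only [add_zero] at b1 b2 b3 ⊢
  omega

/-! ### Computable predicates, sums and arithmetic -/

variable {P Q : β → Prop}

theorem Comp.pos (hf : Comp bd Γ f) : CompP bd Γ fun b => f b ≠ 0 :=
  ⟨f, hf, fun _ _ => Iff.rfl⟩

theorem CompP.congr (hP : CompP bd Γ P) (e : ∀ b, Γ.dom b → (P b ↔ Q b)) : CompP bd Γ Q := by
  obtain ⟨k, hk, h⟩ := hP
  exact ⟨k, hk, fun b hb => (h b hb).trans (e b hb)⟩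

theorem CompP.lt (hf : Comp bd Γ f) (hg : Comp bd Γ g) : CompP bd Γ fun b => f b < g b :=
  ⟨_, hg.sub hf, fun b _ => by omega⟩

theorem CompP.not (hP : CompP bd Γ P) : CompP bd Γ fun b => ¬ P b := by
  obtain ⟨k, hk, h⟩ := hP
  refine ⟨_, (Comp.const 1).sub hk, fun b hb => ?_⟩
  change _ ↔ ¬ P b
  rw [← h b hb]
  omega

theorem CompP.or (hP : CompP bd Γ P) (hQ : CompP bd Γ Q) : CompP bd Γ fun b => P b ∨ Q b := by
  obtain ⟨k, hk, h⟩ := hP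
  obtain ⟨l, hl, h'⟩ := hQ
  refine ⟨_, hk.add hl, fun b hb => ?_⟩
  change _ ↔ P b ∨ Q b
  rw [← h b hb, ← h' b hb]
  omega

theorem CompP.and (hP : CompP bd Γ P) (hQ : CompP bd Γ Q) : CompP bd Γ fun b => P b ∧ Q b :=
  (hP.not.or hQ.not).not.congr fun b _ => by tauto

theorem CompP.imp (hP : CompP bd Γ P) (hQ : CompP bd Γ Q) : CompP bd Γ fun b => P b → Q b :=
  (hP.not.or hQ).congr fun b _ => by tauto

theorem CompP.iff (hP : CompP bd Γ P) (hQ : CompP bd Γ Q) : CompP bd Γ fun b => (P b ↔ Q b) :=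
  ((hP.imp hQ).and (hQ.imp hP)).congr fun b _ => by tauto

theorem CompP.le (hf : Comp bd Γ f) (hg : Comp bd Γ g) : CompP bd Γ fun b => f b ≤ g b :=
  (CompP.lt hg hf).not.congr fun _ _ => not_lt

theorem CompP.eq (hf : Comp bd Γ f) (hg : Comp bd Γ g) : CompP bd Γ fun b => f b = g b :=
  ((CompP.le hf hg).and (CompP.le hg hf)).congr fun _ _ => le_antisymm_iff.symm

theorem iter_add_eq_sum (F : ℕ → ℕ) (k : ℕ) :
    iter 0 (fun i x => x + F i) k = ∑ i ∈ Finset.range k, F i := by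
  induction k with
  | zero => rfl
  | succ k ih => rw [iter, ih, Finset.sum_range_succ]

theorem Comp.sum {cnt : β → ℕ} {F : β → ℕ → ℕ} (hc : Comp bd Γ cnt)
    (hF : Comp bd (Γ.loop cnt) fun b => F b.1 b.2.1)
    (hle : ∀ b, Γ.dom b → cnt b ≤ bd (Γ.inp b)) :
    Comp bd Γ fun b => ∑ i ∈ Finset.range (cnt b), F b i :=
  (hc.iter (.const 0) (Comp.acc.add hF) hle).congr fun b _ => iter_add_eq_sum (F b) (cnt b)

theorem Comp.mul (hf : Comp bd Γ f) (hg : Comp bd Γ g)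
    (hle : ∀ b, Γ.dom b → g b ≤ bd (Γ.inp b)) : Comp bd Γ fun b => f b * g b :=
  (hg.sum (F := fun b _ => f b) (hf.weaken g) hle).congr fun b _ => by simp [mul_comm]

theorem Comp.pow (hf : Comp bd Γ f) (hg : Comp bd Γ g)
    (hlf : ∀ b, Γ.dom b → f b ≤ bd (Γ.inp b)) (hlg : ∀ b, Γ.dom b → g b ≤ bd (Γ.inp b)) :
    Comp bd Γ fun b => f b ^ g b :=
  (hg.iter (.const 1) (Comp.acc.mul (hf.weaken g) fun b hb => hlf b.1 hb.1) hlg).congr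
    fun b _ => by
      induction g b with
      | zero => rfl
      | succ k ih => rw [RAM.iter, ih, pow_succ]

theorem CompP.exists_lt {cnt : β → ℕ} {R : β → ℕ → Prop} (hc : Comp bd Γ cnt)
    (hR : CompP bd (Γ.loop cnt) fun b => R b.1 b.2.1)
    (hle : ∀ b, Γ.dom b → cnt b ≤ bd (Γ.inp b)) :
    CompP bd Γ fun b => ∃ i < cnt b, R b i := by
  classical
  refine ⟨_, hc.sum (F := fun b i => if R b i then 1 else 0) (Comp.ite hR (.const 1) (.const 0))
    hle, fun b _ => ?_⟩
  simp

theorem CompP.forall_lt {cnt : β → ℕ} {R : β → ℕ → Prop} (hc : Comp bd Γ cnt)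
    (hR : CompP bd (Γ.loop cnt) fun b => R b.1 b.2.1)
    (hle : ∀ b, Γ.dom b → cnt b ≤ bd (Γ.inp b)) :
    CompP bd Γ fun b => ∀ i < cnt b, R b i :=
  (CompP.exists_lt (R := fun b i => ¬ R b i) hc hR.not hle).not.congr fun b _ => by push Not; rfl

/-- Division by counting multiples of the divisor. -/
theorem card_multiples (x y : ℕ) (hy : 0 < y) :
    (∑ k ∈ Finset.range x, if y * (k + 1) ≤ x then 1 else 0) = x / y := by
  rw [Finset.sum_boole]
  have : ({k ∈ Finset.range x | y * (k + 1) ≤ x} : Finset ℕ) = Finset.range (x / y) := by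
    ext k
    have := Nat.div_le_self x y
    simp only [Finset.mem_filter, Finset.mem_range, mul_comm y, ← Nat.le_div_iff_mul_le hy]
    omega
  simp [this]

theorem Comp.div (hf : Comp bd Γ f) (hg : Comp bd Γ g)
    (hlf : ∀ b, Γ.dom b → f b ≤ bd (Γ.inp b)) : Comp bd Γ fun b => f b / g b := by
  refine (Comp.ite (CompP.lt (.const 0) hg)
    (hf.sum (F := fun b k => if g b * (k + 1) ≤ f b then 1 else 0)
      (Comp.ite (CompP.le ((hg.weaken f).mul (Comp.index.add (.const 1)) ?_) (hf.weaken f))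
        (.const 1) (.const 0)) hlf) (.const 0)).congr fun b _ => ?_
  · intro b hb
    have := hlf b.1 hb.1
    have := hb.2
    change b.2.1 + 1 ≤ bd (Γ.inp b.1)
    omega
  · split_ifs with h
    · exact card_multiples _ _ h
    · simp [Nat.eq_zero_of_not_pos h]

theorem Comp.mod (hf : Comp bd Γ f) (hg : Comp bd Γ g)
    (hlf : ∀ b, Γ.dom b → f b ≤ bd (Γ.inp b)) : Comp bd Γ fun b => f b % g b :=
  (hf.sub (hg.mul (hf.div hg hlf) fun b hb => (Nat.div_le_self _ _).trans (hlf b hb))).congr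
    fun b _ => by rw [Nat.mod_eq_sub_mul_div]

/-- The valuation without local variables, whose unused slots all refer to the variable `0`. -/
def Ctx.nil (dom : State → Prop) : Ctx State where
  inp := id
  env _ a := a.var 0
  dom := dom

/-- A computable function can be tabulated into array `2`. -/
theorem Comp.exists_table {dom : State → Prop} {cnt : State → ℕ} {F : State → ℕ → ℕ}
    (hc : Comp bd (Ctx.nil dom) cnt)
    (hF : Comp bd ((Ctx.nil dom).loop cnt) fun b => F b.1 b.2.1)
    (hle : ∀ a, dom a → cnt a ≤ bd a) :
    ∃ (p : Prog) (K : ℕ), ∀ a, dom a → ∃ t s, Exec p a t s ∧ t ≤ K * (bd a + 1) ^ K ∧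
      ∀ i < cnt a, s.arr 2 i = F a i := by
  obtain ⟨pc, Kc, Hc⟩ := hc (fun _ => 0) 2 (by omega) (by omega)
  obtain ⟨pb, Kb, Hb⟩ := hF (fun i => if i = 1 then 1 else 0) 3 (by omega)
    (fun i => by split_ifs <;> omega)
  let step : Prog := .seq pb (.seq (.store 2 (.var 1) (.var 3))
    (.assign 1 (.add (.var 1) (.const 1))))
  let cond : Exp := .sub (.var 2) (.var 1)
  let W : Prog := .while cond step
  refine ⟨.seq pc (.seq (.assign 1 (.const 0)) W), Kc + (Kb + 0 + 20 + 1) + 8, fun a ha => ?_⟩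
  obtain ⟨t, s, h1, h2, h3, h4, h5⟩ := Hc a ha a ⟨rfl, rfl, rfl, fun _ => rfl⟩
  -- The loop, started when `k` entries are missing, adds these entries.
  have key : ∀ k ≤ cnt a, ∀ u : State, u.arr 0 = a.arr 0 → u.arr 1 = a.arr 1 →
      u.var 0 = a.var 0 → u.var 1 = cnt a - k → u.var 2 = cnt a →
      (∀ i < cnt a - k, u.arr 2 i = F a i) →
      ∃ T u', Exec W u T u' ∧ T ≤ k * (Kb * (bd a + 1) ^ Kb + 20) + 4 ∧
        ∀ i < cnt a, u'.arr 2 i = F a i := by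
    intro k
    induction k with
    | zero =>
      intro _ u _ _ _ h1 h2 h6
      refine ⟨_, u, .while_false ?_, ?_, h6⟩
      · simp [cond, Exp.eval, h1, h2]
      · simp [cond, Exp.cost]
    | succ k ih =>
      intro hk u a0 a1 v0 v1 v2 h6
      obtain ⟨tb, v, e1, e2, e3, e4, e5⟩ := Hb (a, cnt a - (k + 1), a.var 0)
        ⟨ha, by change cnt a - (k + 1) < cnt a; omega⟩ u
        ⟨v0, a0, a1, by rintro (_ | _ | i) <;> simp [v0, v1, Ctx.loop, Ctx.nil]⟩
      let w₁ := v.setArr 2 (v.var 1) (v.var 3)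
      let w₂ := w₁.setVar 1 (w₁.var 1 + 1)
      have hstep : Exec step u (tb + (3 + 4)) w₂ :=
        .seq e1 (.seq (.store _ _ _ _) (.assign _ _ _))
      obtain ⟨T, u', g1, g2, g3⟩ := ih (by omega) w₂
        (by simp [w₂, w₁, State.setVar, State.setArr, e3, a0])
        (by simp [w₂, w₁, State.setVar, State.setArr, e3, a1])
        (by simp [w₂, w₁, State.setVar, State.setArr, e4 0, v0])
        (by
          simp only [w₂, w₁, State.setVar, State.setArr, Function.update_self, e4 1 (by omega), v1]
          omega)
        (by simp [w₂, w₁, State.setVar, State.setArr, e4 2, v2])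
        (by
          intro i hi
          have : w₂.arr 2 i = if i = cnt a - (k + 1) then v.var 3 else u.arr 2 i := by
            simp [w₂, w₁, State.setVar, State.setArr, Function.update, e4 1, v1, e3]
          rw [this, e5]
          split_ifs with hi'
          · rw [hi']
          · exact h6 i (by omega))
      have hcond : cond.eval u ≠ 0 := by
        simp only [cond, Exp.eval, v1, v2]
        omega
      refine ⟨_, u', .while_true hcond hstep g1, ?_, g3⟩
      have e2' : tb ≤ Kb * (bd a + 1) ^ Kb := e2
      simp only [cond, Exp.cost]
      rw [add_mul]
      omega
  obtain ⟨T, u', g1, g2, g3⟩ := key (cnt a) le_rfl (s.setVar 1 0)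
    (by simp [State.setVar, h3]) (by simp [State.setVar, h3]) (by simp [State.setVar, h4 0])
    (by simp [State.setVar]) (by simp [State.setVar, h5]) (by simp)
  refine ⟨_, u', .seq h1 (.seq (.assign _ _ _) g1), ?_, g3⟩
  have b2 := poly_mul (hle a ha)
    (poly_add (X := bd a) (c := 20) (le_refl (Kb * (bd a + 1) ^ Kb)) (K₂ := 0) (t₂ := 0) (by simp))
  have b3 := poly_add (c := 8) h2 b2
  simp only [Exp.cost]
  simp only [add_zero, Ctx.nil, id] at b2 b3 ⊢
  omega

end RAM

namespace STC

open RAM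

noncomputable section

open Classical

/-! ### The algorithm -/

/-- Adjacency in the graph stored in array `0` of `a`. -/
def Edge (a : State) (u v : ℕ) : Prop := a.arr 0 (u * a.var 0 + v) ≠ 0

/-- Membership in the set stored in array `1` of `a`. -/
def InS (a : State) (v : ℕ) : Prop := a.arr 1 v ≠ 0

/-- The size of the set stored in array `1` of `a`. -/
def sizeS (a : State) : ℕ := ∑ v ∈ Finset.range (a.var 0), if InS a v then 1 else 0

/-- A bound on the number of vertices whose parents have to be listed explicitly, as in
`exists_short_description`. -/
def listLen (a : State) : ℕ := 11 * (sizeS a * sizeS a + 1)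

/-- `u` and `v` have the same neighbours in `S`. -/
def Twin (a : State) (u v : ℕ) : Prop := ∀ s < a.var 0, InS a s → (Edge a u s ↔ Edge a v s)

/-- The vertices considered by the search: those in `S`, and the first few of every class of twins
outside of `S`. Since twins can be exchanged, it is enough to keep as many of every class as there
are vertices in a candidate. -/
def Pool (a : State) (v : ℕ) : Prop :=
  InS a v ∨ (∑ u ∈ Finset.range (a.var 0), if u < v ∧ ¬ InS a u ∧ Twin a u v then 1 else 0) <
    2 * listLen a + 2

/-- The number of vertices of the pool preceding `v`. -/
def poolRank (a : State) (v : ℕ) : ℕ :=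
  ∑ u ∈ Finset.range (a.var 0), if u < v ∧ Pool a u then 1 else 0

/-- The number of vertices of the pool. -/
def poolSize (a : State) : ℕ := ∑ u ∈ Finset.range (a.var 0), if Pool a u then 1 else 0

/-- The vertex number `j` of the pool. -/
def poolElt (a : State) (j : ℕ) : ℕ :=
  iter 0 (fun v x => if Pool a v ∧ poolRank a v = j then v else x) (a.var 0)

/-- The length of a candidate: a root, a default parent, and `listLen a` pairs. -/
def numDigits (a : State) : ℕ := 2 * listLen a + 2

/-- The number of candidates, which are the sequences of `numDigits a` vertices of the pool. They
are encoded by the numbers less than `numCand a`, read to the base `poolSize a`. -/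
def numCand (a : State) : ℕ := poolSize a ^ numDigits a

/-- The vertex number `j` of the candidate `x`. -/
def candVertex (a : State) (x j : ℕ) : ℕ := poolElt a (x / poolSize a ^ j % poolSize a)

/-- The parent of `v` in the candidate `x`. The first vertex of the candidate is the root, the
second one is the parent of all vertices not listed, and then follow pairs of a vertex and its
parent. -/
def candParent (a : State) (x v : ℕ) : ℕ :=
  if v = candVertex a x 0 then v else
    iter (candVertex a x 1)
      (fun j y => if candVertex a x (2 * j + 2) = v then candVertex a x (2 * j + 3) else y)
      (listLen a)

/-- The `k`-th iterated parent of `v` in the candidate `x`. -/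
def candAncestor (a : State) (x v k : ℕ) : ℕ := iter v (fun _ y => candParent a x y) k

/-- `u` is a descendant of `v` in the candidate `x`. In a tree with `n` vertices, `n` steps suffice
to get from `u` to any of its ancestors. -/
def CandBelow (a : State) (x v u : ℕ) : Prop := ∃ k < a.var 0 + 1, candAncestor a x u k = v

/-- The candidate `x` describes a spanning tree. -/
def CandValid (a : State) (x : ℕ) : Prop :=
  (∀ v < a.var 0, v ≠ candVertex a x 0 → Edge a v (candParent a x v)) ∧
    ∀ v < a.var 0, candAncestor a x v (a.var 0) = candVertex a x 0

/-- The congestion of the edge between `v` and its parent. -/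
def candCut (a : State) (x v : ℕ) : ℕ :=
  ∑ u ∈ Finset.range (a.var 0), ∑ w ∈ Finset.range (a.var 0),
    if Edge a u w ∧ CandBelow a x v u ∧ ¬ CandBelow a x v w then 1 else 0

/-- The maximum of `candCut a x v` over the vertices `v` other than the root. -/
def candCong (a : State) (x : ℕ) : ℕ :=
  iter 0 (fun v y => if v ≠ candVertex a x 0 ∧ y < candCut a x v then candCut a x v else y)
    (a.var 0)

/-- The congestion of a valid candidate, which is at most `n * n`, and a larger number for the
other candidates. -/
def candCost (a : State) (x : ℕ) : ℕ :=
  if CandValid a x then candCong a x else a.var 0 * a.var 0 + 1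

/-- The minimum of the costs of all candidates. -/
def minCost (a : State) : ℕ :=
  iter (a.var 0 * a.var 0 + 1) (fun x y => if candCost a x < y then candCost a x else y) (numCand a)

/-- A candidate of minimum cost. -/
def bestCand (a : State) : ℕ :=
  iter 0 (fun x y => if candCost a x = minCost a then x else y) (numCand a)

/-- The adjacency matrix of the best candidate. -/
def output (a : State) (i : ℕ) : ℕ :=
  if ∃ u < a.var 0, ∃ v < a.var 0, i = u * a.var 0 + v ∧
    ((u ≠ candVertex a (bestCand a) 0 ∧ candParent a (bestCand a) u = v) ∨
      (v ≠ candVertex a (bestCand a) 0 ∧ candParent a (bestCand a) v = u)) then 1 else 0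

/-- An upper bound for the numbers of rounds of all loops of the algorithm; the last summand takes
care of small constants. -/
def bound (a : State) : ℕ := a.var 0 * a.var 0 + numDigits a + numCand a + 50

end

theorem sizeS_le (a : State) : sizeS a ≤ a.var 0 := by
  classical
  rw [sizeS, Finset.sum_boole]
  exact (Finset.card_filter_le _ _).trans (by simp)

theorem poolSize_le (a : State) : poolSize a ≤ a.var 0 := by
  classical
  rw [poolSize, Finset.sum_boole]
  exact (Finset.card_filter_le _ _).trans (by simp)

theorem size_le_bound (a : State) : a.var 0 ≤ bound a := by
  have := Nat.le_mul_self (a.var 0)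
  unfold bound
  omega

theorem listLen_le_bound (a : State) : 2 * listLen a + 2 ≤ bound a := by
  unfold bound numDigits
  omega

/-! ### The algorithm runs in polynomial time relative to `bound` -/

section Comp

variable {β : Type} {Γ : Ctx β} {f g h : β → ℕ}

theorem comp_inS (hf : Comp bound Γ f) : CompP bound Γ fun b => InS (Γ.inp b) (f b) :=
  hf.get₁.pos

theorem comp_edge (hf : Comp bound Γ f) (hg : Comp bound Γ g) :
    CompP bound Γ fun b => Edge (Γ.inp b) (f b) (g b) :=
  ((hf.mul Comp.size fun _ _ => size_le_bound _).add hg).get₀.pos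

theorem comp_sizeS : Comp bound Γ fun b => sizeS (Γ.inp b) := by
  classical
  exact Comp.size.sum (F := fun b v => if InS (Γ.inp b) v then 1 else 0)
    (.ite (comp_inS .index) (.const 1) (.const 0)) fun _ _ => size_le_bound _

theorem comp_listLen : Comp bound Γ fun b => listLen (Γ.inp b) := by
  refine (Comp.mul ((comp_sizeS.mul comp_sizeS fun b _ => ?_).add (.const 1)) (.const 11)
    fun b _ => ?_).congr fun b _ => mul_comm _ _
  · exact (sizeS_le _).trans (size_le_bound _)
  · unfold bound
    omega

theorem comp_numDigits : Comp bound Γ fun b => numDigits (Γ.inp b) := by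
  refine ((comp_listLen.mul (.const 2) fun b _ => ?_).add (.const 2)).congr fun b _ => ?_
  · unfold bound
    omega
  · rw [numDigits, mul_comm]

theorem comp_twin (hf : Comp bound Γ f) (hg : Comp bound Γ g) :
    CompP bound Γ fun b => Twin (Γ.inp b) (f b) (g b) :=
  CompP.forall_lt (R := fun b s => InS (Γ.inp b) s →
      (Edge (Γ.inp b) (f b) s ↔ Edge (Γ.inp b) (g b) s)) Comp.size
    ((comp_inS .index).imp ((comp_edge (hf.weaken _) .index).iff (comp_edge (hg.weaken _) .index)))
    fun _ _ => size_le_bound _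

theorem comp_pool (hf : Comp bound Γ f) : CompP bound Γ fun b => Pool (Γ.inp b) (f b) := by
  classical
  exact (comp_inS hf).or (CompP.lt (Comp.size.sum
    (F := fun b u => if u < f b ∧ ¬ InS (Γ.inp b) u ∧ Twin (Γ.inp b) u (f b) then 1 else 0)
    (.ite ((CompP.lt .index (hf.weaken _)).and ((comp_inS .index).not.and
      (comp_twin .index (hf.weaken _)))) (.const 1) (.const 0)) fun _ _ => size_le_bound _)
    comp_numDigits)

theorem comp_poolRank (hf : Comp bound Γ f) :
    Comp bound Γ fun b => poolRank (Γ.inp b) (f b) := by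
  classical
  exact Comp.size.sum (F := fun b u => if u < f b ∧ Pool (Γ.inp b) u then 1 else 0)
    (.ite ((CompP.lt .index (hf.weaken _)).and (comp_pool .index)) (.const 1) (.const 0))
    fun _ _ => size_le_bound _

theorem comp_poolSize : Comp bound Γ fun b => poolSize (Γ.inp b) := by
  classical
  exact Comp.size.sum (F := fun b u => if Pool (Γ.inp b) u then 1 else 0)
    (.ite (comp_pool .index) (.const 1) (.const 0)) fun _ _ => size_le_bound _

theorem comp_poolElt (hf : Comp bound Γ f) :
    Comp bound Γ fun b => poolElt (Γ.inp b) (f b) := by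
  classical
  exact Comp.size.iter (.const 0) (body := fun b =>
      if Pool (Γ.inp b.1) b.2.1 ∧ poolRank (Γ.inp b.1) b.2.1 = f b.1 then b.2.1 else b.2.2)
    (.ite ((comp_pool .index).and (.eq (comp_poolRank .index) (hf.weaken _))) .index .acc)
    fun _ _ => size_le_bound _

theorem comp_numCand : Comp bound Γ fun b => numCand (Γ.inp b) :=
  comp_poolSize.pow comp_numDigits (fun _ _ => (poolSize_le _).trans (size_le_bound _))
    fun _ _ => listLen_le_bound _

theorem comp_candVertex (hf : Comp bound Γ f) (hg : Comp bound Γ g)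
    (hlf : ∀ b, Γ.dom b → f b ≤ bound (Γ.inp b)) (hlg : ∀ b, Γ.dom b → g b ≤ bound (Γ.inp b)) :
    Comp bound Γ fun b => candVertex (Γ.inp b) (f b) (g b) :=
  comp_poolElt ((hf.div (comp_poolSize.pow hg (fun _ _ => (poolSize_le _).trans (size_le_bound _))
    hlg) hlf).mod comp_poolSize fun b hb => (Nat.div_le_self _ _).trans (hlf b hb))

theorem comp_candParent (hf : Comp bound Γ f) (hg : Comp bound Γ g)
    (hlf : ∀ b, Γ.dom b → f b ≤ bound (Γ.inp b)) :
    Comp bound Γ fun b => candParent (Γ.inp b) (f b) (g b) := by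
  classical
  have h2 : ∀ c, Comp bound (Γ.loop fun b => listLen (Γ.inp b)) fun b => 2 * b.2.1 + c := fun c =>
    ((Comp.index.add .index).add (.const c)).congr fun b _ => by omega
  refine .ite (.eq hg (comp_candVertex hf (.const 0) hlf fun b _ => Nat.zero_le _)) hg
    (comp_listLen.iter (comp_candVertex hf (.const 1) hlf fun b _ => ?_) (body := fun b =>
      if candVertex (Γ.inp b.1) (f b.1) (2 * b.2.1 + 2) = g b.1
        then candVertex (Γ.inp b.1) (f b.1) (2 * b.2.1 + 3) else b.2.2)
      (.ite (.eq (comp_candVertex (hf.weaken _) (h2 2) (fun b hb => hlf b.1 hb.1) ?_) (hg.weaken _))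
        (comp_candVertex (hf.weaken _) (h2 3) (fun b hb => hlf b.1 hb.1) ?_) .acc) fun b _ => ?_)
  · unfold bound
    omega
  · intro b hb
    have : b.2.1 < listLen (Γ.inp b.1) := hb.2
    exact le_trans (by omega) (listLen_le_bound (Γ.inp b.1))
  · intro b hb
    have : b.2.1 < listLen (Γ.inp b.1) := hb.2
    exact le_trans (by omega) (listLen_le_bound (Γ.inp b.1))
  · exact le_trans (by omega) (listLen_le_bound (Γ.inp b))

theorem comp_candAncestor (hf : Comp bound Γ f) (hg : Comp bound Γ g) (hh : Comp bound Γ h)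
    (hlf : ∀ b, Γ.dom b → f b ≤ bound (Γ.inp b)) (hlh : ∀ b, Γ.dom b → h b ≤ bound (Γ.inp b)) :
    Comp bound Γ fun b => candAncestor (Γ.inp b) (f b) (g b) (h b) :=
  hh.iter hg (body := fun b => candParent (Γ.inp b.1) (f b.1) b.2.2)
    (comp_candParent (hf.weaken _) .acc fun b hb => hlf b.1 hb.1) hlh

theorem comp_candBelow (hf : Comp bound Γ f) (hg : Comp bound Γ g) (hh : Comp bound Γ h)
    (hlf : ∀ b, Γ.dom b → f b ≤ bound (Γ.inp b)) :
    CompP bound Γ fun b => CandBelow (Γ.inp b) (f b) (g b) (h b) := by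
  have hn : ∀ b, (Γ.inp b).var 0 + 1 ≤ bound (Γ.inp b) := fun b => by
    have := Nat.le_mul_self ((Γ.inp b).var 0)
    unfold bound
    omega
  refine CompP.exists_lt (R := fun b k => candAncestor (Γ.inp b) (f b) (h b) k = g b)
    (Comp.size.add (.const 1))
    (.eq (comp_candAncestor (hf.weaken _) (hh.weaken _) .index (fun b hb => hlf b.1 hb.1)
      fun b hb => ?_) (hg.weaken _)) fun b _ => hn b
  exact hb.2.le.trans (hn b.1)

theorem comp_candValid (hf : Comp bound Γ f) (hlf : ∀ b, Γ.dom b → f b ≤ bound (Γ.inp b)) :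
    CompP bound Γ fun b => CandValid (Γ.inp b) (f b) := by
  have h0 : Comp bound Γ fun b => candVertex (Γ.inp b) (f b) 0 :=
    comp_candVertex hf (.const 0) hlf fun _ _ => Nat.zero_le _
  exact (CompP.forall_lt (R := fun b v => v ≠ candVertex (Γ.inp b) (f b) 0 →
      Edge (Γ.inp b) v (candParent (Γ.inp b) (f b) v)) Comp.size
    ((CompP.eq .index (h0.weaken _)).not.imp (comp_edge .index
      (comp_candParent (hf.weaken _) .index fun b hb => hlf b.1 hb.1))) fun _ _ =>
        size_le_bound _).and
    (CompP.forall_lt (R := fun b v => candAncestor (Γ.inp b) (f b) v ((Γ.inp b).var 0) =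
        candVertex (Γ.inp b) (f b) 0) Comp.size
      (CompP.eq (comp_candAncestor (hf.weaken _) .index .size (fun b hb => hlf b.1 hb.1)
        fun _ _ => size_le_bound _) (h0.weaken _)) fun _ _ => size_le_bound _)

theorem comp_candCut (hf : Comp bound Γ f) (hg : Comp bound Γ g)
    (hlf : ∀ b, Γ.dom b → f b ≤ bound (Γ.inp b)) :
    Comp bound Γ fun b => candCut (Γ.inp b) (f b) (g b) := by
  classical
  exact Comp.size.sum (F := fun b u => ∑ w ∈ Finset.range ((Γ.inp b).var 0),
      if Edge (Γ.inp b) u w ∧ CandBelow (Γ.inp b) (f b) (g b) u ∧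
        ¬ CandBelow (Γ.inp b) (f b) (g b) w then 1 else 0)
    (Comp.size.sum (F := fun (b : β × ℕ × ℕ) w => if Edge (Γ.inp b.1) b.2.1 w ∧
        CandBelow (Γ.inp b.1) (f b.1) (g b.1) b.2.1 ∧
        ¬ CandBelow (Γ.inp b.1) (f b.1) (g b.1) w then 1 else 0)
      (.ite ((comp_edge (Comp.index.weaken _) .index).and
        ((comp_candBelow ((hf.weaken _).weaken _) ((hg.weaken _).weaken _) (Comp.index.weaken _)
            fun b hb => hlf b.1.1 hb.1.1).and
          (comp_candBelow ((hf.weaken _).weaken _) ((hg.weaken _).weaken _) .index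
            fun b hb => hlf b.1.1 hb.1.1).not)) (.const 1) (.const 0))
      fun _ _ => size_le_bound _) fun _ _ => size_le_bound _

theorem comp_candCost (hf : Comp bound Γ f) (hlf : ∀ b, Γ.dom b → f b ≤ bound (Γ.inp b)) :
    Comp bound Γ fun b => candCost (Γ.inp b) (f b) := by
  classical
  have h0 : Comp bound Γ fun b => candVertex (Γ.inp b) (f b) 0 :=
    comp_candVertex hf (.const 0) hlf fun _ _ => Nat.zero_le _
  have h1 : Comp bound (Γ.loop fun b => (Γ.inp b).var 0) fun b =>
      candCut (Γ.inp b.1) (f b.1) b.2.1 :=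
    comp_candCut (hf.weaken _) .index fun b hb => hlf b.1 hb.1
  exact .ite (comp_candValid hf hlf)
    (Comp.size.iter (.const 0) (body := fun b =>
      if b.2.1 ≠ candVertex (Γ.inp b.1) (f b.1) 0 ∧ b.2.2 < candCut (Γ.inp b.1) (f b.1) b.2.1
        then candCut (Γ.inp b.1) (f b.1) b.2.1 else b.2.2)
      (.ite ((CompP.eq .index (h0.weaken _)).not.and (.lt .acc h1)) h1 .acc)
      fun _ _ => size_le_bound _)
    ((Comp.size.mul .size fun _ _ => size_le_bound _).add (.const 1))

theorem numCand_le_bound (a : State) : numCand a ≤ bound a := by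
  unfold bound
  omega

theorem comp_minCost : Comp bound Γ fun b => minCost (Γ.inp b) := by
  classical
  have h1 : Comp bound (Γ.loop fun b => numCand (Γ.inp b)) fun b => candCost (Γ.inp b.1) b.2.1 :=
    comp_candCost .index fun b hb => hb.2.le.trans (numCand_le_bound (Γ.inp b.1))
  exact comp_numCand.iter ((Comp.size.mul .size fun _ _ => size_le_bound _).add (.const 1))
    (body := fun b => if candCost (Γ.inp b.1) b.2.1 < b.2.2 then candCost (Γ.inp b.1) b.2.1
      else b.2.2)
    (.ite (.lt h1 .acc) h1 .acc) fun _ _ => numCand_le_bound _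

theorem comp_bestCand : Comp bound Γ fun b => bestCand (Γ.inp b) := by
  classical
  have h1 : Comp bound (Γ.loop fun b => numCand (Γ.inp b)) fun b => candCost (Γ.inp b.1) b.2.1 :=
    comp_candCost .index fun b hb => hb.2.le.trans (numCand_le_bound (Γ.inp b.1))
  exact comp_numCand.iter (.const 0)
    (body := fun b => if candCost (Γ.inp b.1) b.2.1 = minCost (Γ.inp b.1) then b.2.1 else b.2.2)
    (.ite (.eq h1 comp_minCost) .index .acc) fun _ _ => numCand_le_bound _

theorem bestCand_le_bound (a : State) : bestCand a ≤ bound a := by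
  refine le_trans ?_ (numCand_le_bound a)
  unfold bestCand
  generalize numCand a = N
  induction N with
  | zero => exact le_rfl
  | succ k ih =>
    rw [iter]
    split_ifs <;> omega

theorem comp_output (hf : Comp bound Γ f) : Comp bound Γ fun b => output (Γ.inp b) (f b) := by
  classical
  have hl : ∀ {β : Type} {Γ : Ctx β} (b), Γ.dom b → bestCand (Γ.inp b) ≤ bound (Γ.inp b) :=
    fun b _ => bestCand_le_bound _
  have h0 : ∀ {β : Type} {Γ : Ctx β}, Comp bound Γ fun b =>
      candVertex (Γ.inp b) (bestCand (Γ.inp b)) 0 :=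
    comp_candVertex comp_bestCand (.const 0) hl fun _ _ => Nat.zero_le _
  exact .ite (CompP.exists_lt (R := fun b u => ∃ v < (Γ.inp b).var 0,
      f b = u * (Γ.inp b).var 0 + v ∧
      ((u ≠ candVertex (Γ.inp b) (bestCand (Γ.inp b)) 0 ∧
          candParent (Γ.inp b) (bestCand (Γ.inp b)) u = v) ∨
        (v ≠ candVertex (Γ.inp b) (bestCand (Γ.inp b)) 0 ∧
          candParent (Γ.inp b) (bestCand (Γ.inp b)) v = u))) .size
    (CompP.exists_lt (R := fun (b : β × ℕ × ℕ) v => f b.1 = b.2.1 * (Γ.inp b.1).var 0 + v ∧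
      ((b.2.1 ≠ candVertex (Γ.inp b.1) (bestCand (Γ.inp b.1)) 0 ∧
          candParent (Γ.inp b.1) (bestCand (Γ.inp b.1)) b.2.1 = v) ∨
        (v ≠ candVertex (Γ.inp b.1) (bestCand (Γ.inp b.1)) 0 ∧
          candParent (Γ.inp b.1) (bestCand (Γ.inp b.1)) v = b.2.1))) .size
      ((CompP.eq ((hf.weaken _).weaken _)
          (((Comp.index.weaken _).mul .size fun _ _ => size_le_bound _).add .index)).and
        (((CompP.eq (Comp.index.weaken _) h0).not.and
          (.eq (comp_candParent comp_bestCand (Comp.index.weaken _) hl) .index)).or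
          ((CompP.eq .index h0).not.and
          (.eq (comp_candParent comp_bestCand .index hl) (Comp.index.weaken _)))))
      fun _ _ => size_le_bound _) fun _ _ => size_le_bound _) (.const 1) (.const 0)

end Comp

/-- The algorithm as a single machine program. Nothing is assumed about the contents of the memory;
that `output a` is meaningful for inputs `a` is shown separately. -/
theorem exists_prog : ∃ (p : Prog) (K : ℕ), ∀ a : State, ∃ t s, Exec p a t s ∧
    t ≤ K * (bound a + 1) ^ K ∧ ∀ i < a.var 0 * a.var 0, s.arr 2 i = output a i := by
  obtain ⟨p, K, H⟩ := Comp.exists_table (bd := bound) (dom := fun _ => True)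
    (cnt := fun a => a.var 0 * a.var 0) (F := output)
    (Comp.size.mul .size fun _ _ => size_le_bound _) (comp_output .index)
    fun a _ => by unfold bound; omega
  exact ⟨p, K, fun a => H a trivial⟩

/-! ### Rooted spanning trees given by parent functions -/

section Rooted

variable {V : Type*}

/-- `par` maps every vertex other than the root `r` to its parent in a spanning tree of `G`; by
convention the root is its own parent. -/
structure IsParentMap (G : SimpleGraph V) (r : V) (par : V → V) : Prop where
  root : par r = r
  adj : ∀ v, v ≠ r → G.Adj v (par v)
  reach : ∀ v, ∃ k, par^[k] v = r

/-- The descendants of `v`, including `v`. -/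
def below (par : V → V) (v : V) : Set V := {u | ∃ k, par^[k] u = v}

/-- The tree with parent function `par`. -/
def parentGraph (r : V) (par : V → V) : SimpleGraph V where
  Adj u v := u ≠ v ∧ ((u ≠ r ∧ par u = v) ∨ (v ≠ r ∧ par v = u))
  symm := ⟨fun _ _ h => ⟨h.1.symm, h.2.symm⟩⟩
  loopless := ⟨fun _ h => h.1 rfl⟩

/-- The edges of `G` leaving `X`, directed away from `X`. -/
def cutPairs (G : SimpleGraph V) (X : Set V) : Set (V × V) :=
  {e | G.Adj e.1 e.2 ∧ e.1 ∈ X ∧ e.2 ∉ X}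

theorem self_mem_below (par : V → V) (v : V) : v ∈ below par v := ⟨0, rfl⟩

theorem mem_below_of_parent {par : V → V} {u v : V} (h : par u ∈ below par v) :
    u ∈ below par v := by
  obtain ⟨k, hk⟩ := h
  exact ⟨k + 1, hk⟩

theorem parent_mem_below {par : V → V} {u v : V} (h : u ∈ below par v) (hne : u ≠ v) :
    par u ∈ below par v := by
  obtain ⟨k, hk⟩ := h
  cases k with
  | zero => exact absurd hk hne
  | succ k => exact ⟨k, hk⟩

theorem below_trans {par : V → V} {u v w : V} (h : u ∈ below par v) (h' : v ∈ below par w) :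
    u ∈ below par w := by
  obtain ⟨k, hk⟩ := h
  obtain ⟨l, hl⟩ := h'
  exact ⟨l + k, by rw [Function.iterate_add_apply, hk, hl]⟩

namespace IsParentMap

variable {G : SimpleGraph V} {r : V} {par : V → V}

theorem iterate_root (h : IsParentMap G r par) (k : ℕ) : par^[k] r = r :=
  Function.iterate_fixed h.root k

theorem mem_below_root (h : IsParentMap G r par) (v : V) : v ∈ below par r := h.reach v

theorem root_notMem_below (h : IsParentMap G r par) {v : V} (hv : v ≠ r) : r ∉ below par v := by
  rintro ⟨k, hk⟩
  rw [h.iterate_root] at hk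
  exact hv hk.symm

theorem parent_notMem_below (h : IsParentMap G r par) {v : V} (hv : v ≠ r) :
    par v ∉ below par v := by
  rintro ⟨k, hk⟩
  obtain ⟨m, hm⟩ := h.reach v
  -- `v` would be periodic, but its iterates are eventually equal to the root
  have h1 : par^[k + 1] v = v := hk
  have h2 : (par^[k + 1])^[m] v = v := Function.iterate_fixed h1 m
  rw [← Function.iterate_mul, show (k + 1) * m = k * m + m by ring, Function.iterate_add_apply, hm,
    h.iterate_root] at h2
  exact hv h2.symm

theorem parent_ne (h : IsParentMap G r par) {v : V} (hv : v ≠ r) : par v ≠ v :=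
  (h.adj v hv).ne'

theorem graph_adj (h : IsParentMap G r par) {v : V} (hv : v ≠ r) :
    (parentGraph r par).Adj v (par v) :=
  ⟨(h.parent_ne hv).symm, Or.inl ⟨hv, rfl⟩⟩

theorem graph_le (h : IsParentMap G r par) : parentGraph r par ≤ G := by
  rintro u v ⟨_, ⟨hu, rfl⟩ | ⟨hv, rfl⟩⟩
  · exact h.adj u hu
  · exact (h.adj v hv).symm

theorem graph_reachable (h : IsParentMap G r par) (v : V) : (parentGraph r par).Reachable v r := by
  obtain ⟨k, hk⟩ := h.reach v
  induction k generalizing v with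
  | zero => exact hk ▸ .rfl
  | succ k ih =>
    by_cases hv : v = r
    · exact hv ▸ .rfl
    · exact (h.graph_adj hv).reachable.trans (ih (par v) hk)

theorem graph_connected (h : IsParentMap G r par) : (parentGraph r par).Connected :=
  { preconnected := fun u v => (h.graph_reachable u).trans (h.graph_reachable v).symm
    nonempty := ⟨r⟩ }

theorem graph_isTree [Finite V] (h : IsParentMap G r par) : (parentGraph r par).IsTree := by
  classical
  rw [SimpleGraph.isTree_iff_connected_and_card]
  refine ⟨h.graph_connected, le_antisymm ?_ h.graph_connected.card_vert_le_card_edgeSet_add_one⟩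
  have hsub : (parentGraph r par).edgeSet ⊆ (fun v => s(v, par v)) '' {r}ᶜ := by
    intro e he
    induction e with
    | _ u v =>
      have he' : (parentGraph r par).Adj u v := he
      rcases he' with ⟨_, ⟨hu, rfl⟩ | ⟨hv, rfl⟩⟩
      · exact ⟨u, hu, rfl⟩
      · exact ⟨v, hv, Sym2.eq_swap⟩
  have h1 := (Set.ncard_le_ncard hsub).trans (Set.ncard_image_le)
  have h2 := Set.ncard_add_ncard_compl ({r} : Set V)
  rw [Set.ncard_singleton] at h2
  rw [Nat.card_coe_set_eq]
  omega

theorem isSpanningTree [Finite V] (h : IsParentMap G r par) :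
    IsSpanningTree G (parentGraph r par) := ⟨h.graph_le, h.graph_isTree⟩

/-- Removing the edge above `v` leaves the descendants of `v` connected. -/
theorem reachable_of_mem_below (h : IsParentMap G r par) {v x : V} (hv : v ≠ r)
    (hx : x ∈ below par v) :
    ((parentGraph r par).deleteEdges {s(v, par v)}).Reachable x v := by
  obtain ⟨k, hk⟩ := hx
  induction k generalizing x with
  | zero => exact hk ▸ .rfl
  | succ k ih =>
    by_cases hxv : x = v
    · exact hxv ▸ .rfl
    · have hxr : x ≠ r := by
        rintro rfl
        exact h.root_notMem_below hv ⟨k + 1, hk⟩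
      refine SimpleGraph.Reachable.trans (SimpleGraph.Adj.reachable ?_) (ih (x := par x) hk)
      rw [SimpleGraph.deleteEdges_adj]
      refine ⟨h.graph_adj hxr, fun he => ?_⟩
      rcases Sym2.eq_iff.1 (Set.mem_singleton_iff.1 he) with ⟨h1, _⟩ | ⟨h1, _⟩
      · exact hxv h1
      · exact h.parent_notMem_below hv ⟨k + 1, h1 ▸ hk⟩

/-- Removing the edge above `v` leaves the other vertices connected. -/
theorem reachable_of_notMem_below (h : IsParentMap G r par) {v x : V}
    (hx : x ∉ below par v) :
    ((parentGraph r par).deleteEdges {s(v, par v)}).Reachable x r := by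
  obtain ⟨k, hk⟩ := h.reach x
  induction k generalizing x with
  | zero => exact hk ▸ .rfl
  | succ k ih =>
    by_cases hxr : x = r
    · exact hxr ▸ .rfl
    · have hp : par x ∉ below par v := fun hp => hx (mem_below_of_parent hp)
      refine SimpleGraph.Reachable.trans (SimpleGraph.Adj.reachable ?_) (ih (x := par x) hp hk)
      rw [SimpleGraph.deleteEdges_adj]
      refine ⟨h.graph_adj hxr, fun he => ?_⟩
      rcases Sym2.eq_iff.1 (Set.mem_singleton_iff.1 he) with ⟨h1, _⟩ | ⟨_, h1⟩
      · exact hx (h1 ▸ self_mem_below par v)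
      · exact hp (h1 ▸ self_mem_below par v)

/-- Every walk leaving the set of descendants of `v` uses the edge above `v`. -/
theorem mem_edges_of_walk {v : V} {x y : V}
    (p : (parentGraph r par).Walk x y) (hx : x ∈ below par v) (hy : y ∉ below par v) :
    s(v, par v) ∈ p.edges := by
  induction p with
  | nil => exact absurd hx hy
  | @cons a b c hab q ih =>
    rw [SimpleGraph.Walk.edges_cons, List.mem_cons]
    by_cases hb : b ∈ below par v
    · exact Or.inr (ih hb hy)
    · left
      rcases hab.2 with ⟨_, rfl⟩ | ⟨_, rfl⟩
      · by_cases hav : a = v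
        · rw [hav]
        · exact absurd (parent_mem_below hx hav) hb
      · exact absurd (mem_below_of_parent hx) hb

/-- The detour of an edge contains the edge above `v` exactly if the edge has one end below `v`. -/
theorem onDetour_iff [Finite V] (h : IsParentMap G r par) {v : V} (hv : v ≠ r) (x y : V) :
    OnDetour (parentGraph r par) s(x, y) s(v, par v) ↔
      (x ∈ below par v ∧ y ∉ below par v) ∨ (y ∈ below par v ∧ x ∉ below par v) := by
  classical
  -- the two ends of a path through the edge are on different sides
  have key : ∀ (a b : V) (p : (parentGraph r par).Walk a b), p.IsPath →
      s(v, par v) ∈ p.edges →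
      (a ∈ below par v ∧ b ∉ below par v) ∨ (b ∈ below par v ∧ a ∉ below par v) := by
    intro a b p hp he
    by_contra hcon
    have hr : ((parentGraph r par).deleteEdges {s(v, par v)}).Reachable a b := by
      by_cases ha : a ∈ below par v
      · have hb : b ∈ below par v := by tauto
        exact (h.reachable_of_mem_below hv ha).trans (h.reachable_of_mem_below hv hb).symm
      · have hb : b ∉ below par v := by tauto
        exact (h.reachable_of_notMem_below ha).trans (h.reachable_of_notMem_below hb).symm
    obtain ⟨w⟩ := hr
    let w' := (w.mapLe (SimpleGraph.deleteEdges_le _)).toPath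
    have hw : (⟨p, hp⟩ : (parentGraph r par).Path a b) = w' :=
      (h.graph_isTree.isAcyclic.subsingleton_path _ _).elim _ _
    have hpw : p = w'.1 := congrArg Subtype.val hw
    rw [hpw] at he
    have h2 := SimpleGraph.Walk.edges_toPath_subset_edges _ he
    rw [SimpleGraph.Walk.edges_mapLe_eq_edges] at h2
    have h3 := w.edges_subset_edgeSet h2
    rw [SimpleGraph.edgeSet_deleteEdges] at h3
    exact h3.2 rfl
  constructor
  · rintro ⟨a, b, p, hf, hp, he⟩
    have := key a b p hp he
    rcases Sym2.eq_iff.1 hf with ⟨rfl, rfl⟩ | ⟨rfl, rfl⟩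
    · exact this
    · exact this.symm
  · intro hxy
    obtain ⟨w⟩ := h.graph_connected.preconnected x y
    rcases hxy with ⟨hx, hy⟩ | ⟨hy, hx⟩
    · exact ⟨x, y, _, rfl, w.toPath.2, mem_edges_of_walk _ hx hy⟩
    · exact ⟨y, x, _, Sym2.eq_swap, w.reverse.toPath.2, mem_edges_of_walk _ hy hx⟩

theorem edgeCongestion_eq [Finite V] (h : IsParentMap G r par) {v : V} (hv : v ≠ r) :
    edgeCongestion G (parentGraph r par) s(v, par v) = (cutPairs G (below par v)).ncard := by
  have : {f : Sym2 V | f ∈ G.edgeSet ∧ OnDetour (parentGraph r par) f s(v, par v)} =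
      (fun e : V × V => s(e.1, e.2)) '' cutPairs G (below par v) := by
    ext f
    induction f with
    | _ x y =>
      simp only [Set.mem_ofPred_eq, SimpleGraph.mem_edgeSet, h.onDetour_iff hv, Set.mem_image]
      constructor
      · rintro ⟨ha, ⟨hx, hy⟩ | ⟨hy, hx⟩⟩
        · exact ⟨(x, y), ⟨ha, hx, hy⟩, rfl⟩
        · exact ⟨(y, x), ⟨ha.symm, hy, hx⟩, Sym2.eq_swap⟩
      · rintro ⟨⟨a, b⟩, ⟨hadj, ha, hb⟩, he⟩
        rcases Sym2.eq_iff.1 he with ⟨rfl, rfl⟩ | ⟨rfl, rfl⟩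
        · exact ⟨hadj, Or.inl ⟨ha, hb⟩⟩
        · exact ⟨hadj.symm, Or.inr ⟨ha, hb⟩⟩
  rw [edgeCongestion, this, Set.InjOn.ncard_image]
  rintro ⟨a, b⟩ ⟨_, ha, hb⟩ ⟨c, d⟩ ⟨_, hc, hd⟩ he
  rcases Sym2.eq_iff.1 he with ⟨h1, h2⟩ | ⟨h1, h2⟩
  · exact Prod.ext h1 h2
  · exact absurd (h1 ▸ ha) hd

theorem cut_le_treeCongestion [Finite V] (h : IsParentMap G r par) {v : V} (hv : v ≠ r) :
    (cutPairs G (below par v)).ncard ≤ treeCongestion G (parentGraph r par) := by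
  rw [← h.edgeCongestion_eq hv]
  exact le_ciSup (f := fun e : (parentGraph r par).edgeSet =>
    edgeCongestion G (parentGraph r par) e) (Set.finite_range _).bddAbove
    ⟨s(v, par v), h.graph_adj hv⟩

theorem treeCongestion_le [Finite V] (h : IsParentMap G r par) {k : ℕ}
    (hk : ∀ v, v ≠ r → (cutPairs G (below par v)).ncard ≤ k) :
    treeCongestion G (parentGraph r par) ≤ k := by
  refine ciSup_le' ?_
  rintro ⟨e, he⟩
  induction e with
  | _ x y =>
    change edgeCongestion G _ s(x, y) ≤ k
    have he' : (parentGraph r par).Adj x y := he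
    rcases he' with ⟨_, ⟨hx, rfl⟩ | ⟨hy, rfl⟩⟩
    · exact (h.edgeCongestion_eq hx).trans_le (hk x hx)
    · rw [Sym2.eq_swap, h.edgeCongestion_eq hy]
      exact hk y hy

end IsParentMap

/-- A vertex from which `v` can be reached has a neighbour which is closer to `v`. -/
theorem exists_adj_dist_lt {T : SimpleGraph V} {u v : V} (h : T.Reachable u v) (hne : u ≠ v) :
    ∃ w, T.Adj u w ∧ T.dist w v < T.dist u v ∧ T.Reachable w v := by
  obtain ⟨p, hp⟩ := h.exists_walk_length_eq_dist
  cases p with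
  | nil => exact absurd rfl hne
  | @cons _ w _ ha q =>
    refine ⟨w, ha, ?_, q.reachable⟩
    rw [← hp, SimpleGraph.Walk.length_cons]
    exact Nat.lt_succ_of_le (SimpleGraph.dist_le q)

/-- A parent function exists as soon as parents are closer to the root. -/
theorem IsParentMap.of_rank {G : SimpleGraph V} {r : V} {par : V → V} (rank : V → ℕ)
    (root : par r = r) (adj : ∀ v, v ≠ r → G.Adj v (par v))
    (lt : ∀ v, v ≠ r → rank (par v) < rank v) : IsParentMap G r par := by
  refine ⟨root, adj, fun v => ?_⟩
  induction hn : rank v using Nat.strong_induction_on generalizing v with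
  | _ n ih =>
    by_cases hv : v = r
    · exact ⟨0, hv⟩
    · obtain ⟨k, hk⟩ := ih _ (hn ▸ lt v hv) (par v) rfl
      exact ⟨k + 1, hk⟩

/-- Every spanning tree can be rooted. -/
theorem IsSpanningTree.exists_parentMap {G T : SimpleGraph V} (h : IsSpanningTree G T) (r : V) :
    ∃ par, IsParentMap G r par ∧ parentGraph r par = T := by
  classical
  have hex : ∀ v, ∃ w, (v = r → w = r) ∧ (v ≠ r → T.Adj v w ∧ T.dist w r < T.dist v r) := by
    intro v
    by_cases hv : v = r
    · exact ⟨r, fun _ => rfl, fun h => absurd hv h⟩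
    · obtain ⟨w, h1, h2, _⟩ := exists_adj_dist_lt (h.2.1.preconnected v r) hv
      exact ⟨w, fun h => absurd h hv, fun _ => ⟨h1, h2⟩⟩
  choose par h1 h2 using hex
  have hT : IsParentMap T r par :=
    .of_rank (fun v => T.dist v r) (h1 r rfl) (fun v hv => (h2 v hv).1) fun v hv => (h2 v hv).2
  exact ⟨par, ⟨hT.root, fun v hv => h.1 (hT.adj v hv), hT.reach⟩,
    le_antisymm hT.graph_le ((SimpleGraph.isTree_iff_minimal_connected.1 h.2).2 hT.graph_connected
      hT.graph_le)⟩

theorem exists_optimal {G : SimpleGraph V} (hG : G.Connected) [Finite V] :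
    ∃ T, IsSpanningTree G T ∧ treeCongestion G T = stc G := by
  obtain ⟨T, hT⟩ := hG.exists_isTree_le
  exact Nat.sInf_mem (s := {k | ∃ T, IsSpanningTree G T ∧ treeCongestion G T = k})
    ⟨_, T, hT, rfl⟩

theorem stc_le {G T : SimpleGraph V} (hT : IsSpanningTree G T) : stc G ≤ treeCongestion G T :=
  Nat.sInf_le ⟨T, hT, rfl⟩

end Rooted

open Finset

/-! ### Trees of small congestion in graphs with a large clique -/

section CliqueGraph

variable {V : Type*} [Fintype V]

/-- The cut around `X` is counted vertex by vertex. -/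
theorem ncard_cutPairs_le_sum (G : SimpleGraph V) (X : Set V) (Y : Finset V) (hXY : X ⊆ Y)
    (c : V → ℕ) (hc : ∀ x ∈ X, {y | G.Adj x y ∧ y ∉ X}.ncard ≤ c x) :
    (cutPairs G X).ncard ≤ ∑ x ∈ Y, c x := by
  classical
  have h1 : cutPairs G X = (((univ.filter (· ∈ X)).sigma fun x =>
      univ.filter fun y => G.Adj x y ∧ y ∉ X).map
        (Equiv.sigmaEquivProd V V).toEmbedding : Finset (V × V)) := by
    ext ⟨x, y⟩
    simp only [cutPairs, Set.mem_ofPred_eq, coe_map, Set.mem_image, mem_coe, mem_sigma, mem_filter,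
      mem_univ, true_and]
    constructor
    · rintro ⟨h1, h2, h3⟩
      exact ⟨⟨x, y⟩, ⟨h2, h1, h3⟩, rfl⟩
    · rintro ⟨⟨x', y'⟩, ⟨h1, h2, h3⟩, he⟩
      obtain ⟨rfl, rfl⟩ := Prod.mk.inj he
      exact ⟨h2, h1, h3⟩
  rw [h1, Set.ncard_coe_finset, card_map, card_sigma]
  calc _ ≤ ∑ x ∈ univ.filter (· ∈ X), c x := by
        refine sum_le_sum fun x hx => ?_
        have := hc x (by simpa using hx)
        rwa [← coe_filter_univ, Set.ncard_coe_finset] at this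
    _ ≤ _ := sum_le_sum_of_subset fun x hx => by
        have := hXY (show x ∈ X by simpa using hx)
        simpa using this

/-- A system of representatives in which the representatives of the large sets are shared with no
other set. -/
theorem exists_representatives {V : Type*} (S : Finset V) (t : V → Finset V) :
    ∃ w : V → V, (∀ s ∈ S, (t s).Nonempty → w s ∈ t s) ∧
      ∀ s ∈ S, 2 * #S < #(t s) → ∀ s' ∈ S, s' ≠ s → w s' ≠ w s := by
  classical
  have hz : ∀ s, ∃ z, (t s).Nonempty → z ∈ t s := fun s => by
    by_cases h : (t s).Nonempty
    · exact ⟨h.choose, fun _ => h.choose_spec⟩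
    · exact ⟨s, fun h' => absurd h' h⟩
  choose z hz using hz
  let ι := {s // s ∈ S ∧ 2 * #S < #(t s)}
  have hall : ∀ A : Finset ι, #A ≤ #(A.biUnion fun s => t s.1 \ S.image z) := by
    intro A
    rcases A.eq_empty_or_nonempty with rfl | ⟨s, hs⟩
    · simp
    · have h1 : #A ≤ #S := by
        rw [← card_map (Function.Embedding.subtype _)]
        refine card_le_card fun x hx => ?_
        obtain ⟨y, _, rfl⟩ := mem_map.1 hx
        exact y.2.1
      have h2 : #(t s.1 \ S.image z) ≤ #(A.biUnion fun s => t s.1 \ S.image z) :=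
        card_le_card (subset_biUnion_of_mem (fun s : ι => t s.1 \ S.image z) hs)
      have h3 := le_card_sdiff (S.image z) (t s.1)
      have h4 : #(S.image z) ≤ #S := card_image_le
      have := s.2.2
      omega
  obtain ⟨f, hf, hft⟩ := (all_card_le_biUnion_card_iff_exists_injective _).1 hall
  refine ⟨fun s => if h : s ∈ S ∧ 2 * #S < #(t s) then f ⟨s, h⟩ else z s, ?_, ?_⟩
  · intro s hs hne
    dsimp only
    split_ifs with h
    · exact (mem_sdiff.1 (hft ⟨s, h⟩)).1
    · exact hz s hne
  · intro s hs hbig s' hs' hne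
    dsimp only
    rw [dif_pos (show s ∈ S ∧ 2 * #S < #(t s) from ⟨hs, hbig⟩)]
    split_ifs with h
    · exact fun he => hne (congrArg Subtype.val (hf he))
    · intro he
      exact (mem_sdiff.1 (hft ⟨s, hs, hbig⟩)).2 (he ▸ mem_image_of_mem z hs')

/-- The vertices of a set `L` can be hung on vertices outside of `L`, every component of `L` as a
whole on that neighbour outside of `L` at which `μ` is largest. -/
theorem exists_hanging {G : SimpleGraph V} (hG : G.Connected) (L : Finset V) {o : V} (ho : o ∉ L)
    (μ : V → ℕ) :
    ∃ (best par : V → V) (rank : V → ℕ), ∀ l ∈ L, best l ∉ L ∧ G.Adj l (par l) ∧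
      (par l = best l ∨ (par l ∈ L ∧ best (par l) = best l ∧ rank (par l) < rank l)) ∧
      (∃ d ∈ L, G.Adj d (best l)) ∧
      (∀ l' ∈ L, G.Adj l l' → best l' = best l) ∧ ∀ g ∉ L, G.Adj l g → μ g ≤ μ (best l) := by
  classical
  let H : SimpleGraph V :=
    { Adj := fun u v => G.Adj u v ∧ u ∈ L ∧ v ∈ L
      symm := ⟨fun _ _ h => ⟨h.1.symm, h.2.2, h.2.1⟩⟩
      loopless := ⟨fun _ h => G.loopless.irrefl _ h.1⟩ }
  -- the edges leaving a component
  let E : H.ConnectedComponent → Finset (V × V) := fun c =>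
    univ.filter fun e => H.connectedComponentMk e.1 = c ∧ e.1 ∈ L ∧ e.2 ∉ L ∧ G.Adj e.1 e.2
  have hE : ∀ l ∈ L, (E (H.connectedComponentMk l)).Nonempty := by
    intro l hl
    obtain ⟨p⟩ := hG.preconnected l o
    induction p with
    | nil => exact absurd hl ho
    | @cons a b _ hab _ ih =>
      by_cases hb : b ∈ L
      · have : H.connectedComponentMk a = H.connectedComponentMk b :=
          SimpleGraph.ConnectedComponent.sound (SimpleGraph.Adj.reachable ⟨hab, hl, hb⟩)
        rw [this]
        exact ih ho hb
      · exact ⟨(a, b), by simp [E, hl, hb, hab]⟩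
  have hmax : ∀ c, ∃ e : V × V, (E c).Nonempty → e ∈ E c ∧ ∀ e' ∈ E c, μ e'.2 ≤ μ e.2 := by
    intro c
    by_cases h : (E c).Nonempty
    · obtain ⟨e, he⟩ := exists_max_image (E c) (fun e => μ e.2) h
      exact ⟨e, fun _ => he⟩
    · exact ⟨(o, o), fun h' => absurd h' h⟩
  choose e he using hmax
  let door : V → V := fun l => (e (H.connectedComponentMk l)).1
  let best : V → V := fun l => (e (H.connectedComponentMk l)).2
  have hdoor : ∀ l ∈ L, H.Reachable l (door l) ∧ door l ∈ L ∧ best l ∉ L ∧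
      G.Adj (door l) (best l) := by
    intro l hl
    have := (he _ (hE l hl)).1
    simp only [E, mem_filter, mem_univ, true_and] at this
    exact ⟨(SimpleGraph.ConnectedComponent.exact this.1).symm, this.2⟩
  have hpar : ∀ l, ∃ w, l ∈ L → (l = door l ∧ w = best l) ∨
      (H.Adj l w ∧ H.dist w (door l) < H.dist l (door l)) := by
    intro l
    by_cases hl : l ∈ L
    · by_cases hd : l = door l
      · exact ⟨best l, fun _ => Or.inl ⟨hd, rfl⟩⟩
      · obtain ⟨w, h1, h2, _⟩ := exists_adj_dist_lt (hdoor l hl).1 hd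
        exact ⟨w, fun _ => Or.inr ⟨h1, h2⟩⟩
    · exact ⟨l, fun h => absurd h hl⟩
  choose par hpar using hpar
  have hcomp : ∀ l w, H.Adj l w → H.connectedComponentMk w = H.connectedComponentMk l :=
    fun l w h => SimpleGraph.ConnectedComponent.sound h.symm.reachable
  refine ⟨best, par, fun l => H.dist l (door l), fun l hl => ?_⟩
  obtain ⟨_, d1, d2, d3⟩ := hdoor l hl
  refine ⟨d2, ?_, ?_, ⟨_, d1, d3⟩, ?_, ?_⟩
  · rcases hpar l hl with ⟨h1, h2⟩ | ⟨h1, _⟩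
    · rw [h2, h1]
      exact h1 ▸ d3
    · exact h1.1
  · rcases hpar l hl with ⟨_, h2⟩ | ⟨h1, h2⟩
    · exact Or.inl h2
    · have hc := hcomp _ _ h1
      refine Or.inr ⟨h1.2.2, ?_, ?_⟩
      · simp only [best, hc]
      · simpa only [door, hc] using h2
  · intro l' hl' hadj
    simp only [best, hcomp l l' ⟨hadj, hl, hl'⟩]
  · intro g hg hadj
    exact (he _ (hE l hl)).2 (l, g) (by simp [E, hl, hg, hadj])

open scoped Classical in
/-- The number of vertices outside of `S` which are not adjacent to `s`. -/
noncomputable def missing {V : Type*} [Fintype V] [DecidableEq V] (G : SimpleGraph V)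
    (S : Finset V) (s : V) : ℕ :=
  #{k ∈ Sᶜ | ¬ G.Adj s k}

variable [DecidableEq V] {G : SimpleGraph V} {S : Finset V}

open scoped Classical in
/-- A vertex `a` outside of `S` such that, for every `s ∈ S` not adjacent to `a`, few of the
vertices of `S` not adjacent to `a` have at least as many neighbours outside of `S` as `s`.
The expectation of the sum of the numbers `1 / missing s` over the `s ∈ S` not adjacent to a random
vertex outside of `S` is at most `#S / #Sᶜ`; so `a` can be chosen such that this sum is at most
its expectation. -/
theorem exists_center (G : SimpleGraph V) (S : Finset V) (hm : 0 < #Sᶜ) :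
    ∃ a ∉ S, ∀ s ∈ S, ¬ G.Adj s a →
      #Sᶜ * #{s' ∈ S | ¬ G.Adj s' a ∧ missing G S s' ≤ missing G S s} ≤ #S * missing G S s := by
  have hsum : ∑ a ∈ Sᶜ, ∑ s ∈ S, (if ¬ G.Adj s a then (1 : ℚ) / missing G S s else 0) ≤
      ∑ a ∈ Sᶜ, (#S : ℚ) / #Sᶜ := by
    rw [sum_comm, sum_const, nsmul_eq_mul, mul_div_cancel₀ _ (by positivity)]
    calc _ ≤ ∑ s ∈ S, (1 : ℚ) := by
          refine sum_le_sum fun s _ => ?_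
          rw [← sum_filter, sum_const, nsmul_eq_mul]
          change (missing G S s : ℚ) * _ ≤ 1
          rw [mul_one_div]
          exact div_self_le_one _
      _ = _ := by simp
  obtain ⟨a, ha, hle⟩ := exists_le_of_sum_le (card_pos.1 hm) hsum
  refine ⟨a, by simpa using ha, fun s hs hsa => ?_⟩
  have hpos : ∀ s', ¬ G.Adj s' a → 0 < missing G S s' := fun s' h =>
    card_pos.2 ⟨a, by simp [mem_filter, h, mem_compl.1 ha]⟩
  have h1 : (#{s' ∈ S | ¬ G.Adj s' a ∧ missing G S s' ≤ missing G S s} : ℚ) *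
      (1 / missing G S s) ≤ #S / #Sᶜ := by
    refine le_trans ?_ hle
    rw [← nsmul_eq_mul, ← sum_const, ← sum_filter]
    calc _ ≤ ∑ s' ∈ S with ¬ G.Adj s' a ∧ missing G S s' ≤ missing G S s,
          (1 : ℚ) / missing G S s' := by
          refine sum_le_sum fun s' hs' => ?_
          have h := (mem_filter.1 hs').2
          have := hpos s' h.1
          have h2 := h.2
          gcongr
      _ ≤ _ := by
          refine sum_le_sum_of_subset_of_nonneg ?_ fun _ _ _ => by positivity
          intro s' hs'
          simp only [mem_filter] at hs' ⊢
          exact ⟨hs'.1, hs'.2.1⟩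
  have h2 : (0 : ℚ) < missing G S s := by exact_mod_cast hpos s hsa
  have h3 : (0 : ℚ) < #Sᶜ := by exact_mod_cast hm
  rw [mul_one_div, div_le_div_iff₀ h2 h3] at h1
  rw [mul_comm]
  exact_mod_cast h1

/-- The arithmetic behind the congestion of an edge above a clique vertex on which a vertex `s` with
`M = missing s` is hung, together with at most `q` vertices having at most `E` edges to other parts
of the tree. -/
theorem congestion_arith {q m M E : ℕ} (hq : 1 ≤ q) (hm : 10 * (q * q + 1) ≤ m) (hE : 1 ≤ E)
    (hEM : m * E ≤ q * M) : 2 * q + q * E + 4 ≤ M := by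
  have h1 : q * (10 * (q * E)) ≤ q * M := by
    calc q * (10 * (q * E)) ≤ 10 * (q * q + 1) * E := by nlinarith
      _ ≤ m * E := Nat.mul_le_mul_right _ hm
      _ ≤ _ := hEM
  have h2 := Nat.le_of_mul_le_mul_left h1 hq
  have h3 : q * 1 ≤ q * E := Nat.mul_le_mul_left q hE
  omega

open scoped Classical in
/-- If the clique outside of `S` is large compared to its complement, then there is a spanning tree
whose congestion is smaller than `2 * (#Sᶜ - 2)`, the least number of edges of the clique in a cut
with two of its vertices on each side. Its root is the vertex `a`
of `exists_center`. The vertices of `S` which are neither adjacent to `a` nor have all their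
neighbours in `S` are hung on vertices of the clique, separately if they have many neighbours there;
and the vertices with all their neighbours in `S` are hung on the other vertices of `S`, as in
`exists_hanging`. -/
theorem stc_le_of_large_clique (hG : G.Connected) (hK : G.IsClique {v | v ∉ S})
    (hm : 10 * (#S * #S + 1) ≤ #Sᶜ) : stc G + 5 ≤ 2 * #Sᶜ := by
  obtain ⟨a, haS, ha⟩ := exists_center G S (by omega)
  let t : V → Finset V := fun s => {k ∈ Sᶜ | G.Adj s k}
  have ht : ∀ s k, k ∈ t s ↔ k ∉ S ∧ G.Adj s k := fun s k => by simp [t]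
  have htm : ∀ s, #(t s) + missing G S s = #Sᶜ := fun s => card_filter_add_card_filter_not _
  obtain ⟨w, hw, hw'⟩ := exists_representatives S t
  let L : Finset V := {s ∈ S | t s = ∅}
  have hL : ∀ s, s ∈ L ↔ s ∈ S ∧ t s = ∅ := fun s => by simp [L]
  have haL : a ∉ L := fun h => haS ((hL a).1 h).1
  let μ : V → ℕ := fun v => if G.Adj v a then #Sᶜ + 1 else missing G S v
  obtain ⟨best, hang, rank, hhang⟩ := exists_hanging hG L haL μ
  have hLS : ∀ l ∈ L, l ∈ S := fun l hl => ((hL l).1 hl).1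
  have hLk : ∀ l ∈ L, ∀ k, G.Adj l k → k ∈ S := by
    intro l hl k hlk
    by_contra hk
    exact notMem_empty k (((hL l).1 hl).2 ▸ (ht l k).2 ⟨hk, hlk⟩)
  have hbestS : ∀ l ∈ L, best l ∈ S := by
    intro l hl
    obtain ⟨d, hd, hadj⟩ := (hhang l hl).2.2.2.1
    exact hLk d hd _ hadj
  have hbestL : ∀ l ∈ L, best l ∉ L := fun l hl => (hhang l hl).1
  have hwt : ∀ s ∈ S, s ∉ L → w s ∈ t s := fun s hs hsL =>
    hw s hs (nonempty_iff_ne_empty.2 fun h => hsL ((hL s).2 ⟨hs, h⟩))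
  -- the tree
  let par : V → V := fun v =>
    if v ∉ S then a else if v ∈ L then hang v else if G.Adj v a then a else w v
  have parK : ∀ v, v ∉ S → par v = a := fun v hv => by simp [par, hv]
  have parL : ∀ v ∈ L, par v = hang v := fun v hv => by simp [par, hv, hLS v hv]
  have parA : ∀ v ∈ S, v ∉ L → G.Adj v a → par v = a := fun v hv hvL h => by
    simp [par, hv, hvL, h]
  have parW : ∀ v ∈ S, v ∉ L → ¬ G.Adj v a → par v = w v := fun v hv hvL h => by
    simp [par, hv, hvL, h]
  have parNS : ∀ v, v ∉ L → par v ∉ S := by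
    intro v hvL
    by_cases hv : v ∈ S
    · by_cases h : G.Adj v a
      · rwa [parA v hv hvL h]
      · rw [parW v hv hvL h]
        exact ((ht _ _).1 (hwt v hv hvL)).1
    · rwa [parK v hv]
  have hpar : IsParentMap G a par := by
    refine .of_rank (fun v => if v = a then 0 else if v ∉ S then 1 else if v ∉ L then 2
      else 3 + rank v) (parK a haS) (fun v hv => ?_) (fun v hv => ?_)
    · by_cases hvS : v ∈ S
      · by_cases hvL : v ∈ L
        · rw [parL v hvL]
          exact (hhang v hvL).2.1
        · by_cases h : G.Adj v a
          · rwa [parA v hvS hvL h]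
          · rw [parW v hvS hvL h]
            exact ((ht _ _).1 (hwt v hvS hvL)).2
      · rw [parK v hvS]
        exact hK hvS haS hv
    · by_cases hvL : v ∈ L
      · rw [parL v hvL]
        simp only [hv, hvL, hLS v hvL, not_true_eq_false, if_false]
        rcases (hhang v hvL).2.2.1 with h | ⟨h1, _, h3⟩
        · have := hbestL v hvL
          rw [h]
          split_ifs <;> omega
        · have h4 : hang v ≠ a := fun h => haL (h ▸ h1)
          simp only [h4, h1, hLS _ h1, not_true_eq_false, if_false]
          omega
      · have := parNS v hvL
        by_cases hvS : v ∈ S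
        · simp only [hv, hvS, hvL, this, not_true_eq_false, not_false_eq_true, if_true, if_false]
          split_ifs <;> omega
        · simp [parK v hvS, hv, hvS]
  -- the descendants of the vertices of the different kinds
  have belowL : ∀ v ∈ L, ∀ u ∈ below par v, u ∈ L := by
    rintro v hv u ⟨k, hk⟩
    induction k generalizing u with
    | zero =>
      rw [show u = v from hk]
      exact hv
    | succ k ih =>
      by_contra hu
      exact parNS u hu (hLS _ (ih (par u) hk))
  have belowS : ∀ v ∈ S, v ∉ L → ∀ u ∈ below par v, u = v ∨ (u ∈ L ∧ best u = v) := by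
    rintro v hv hvL u ⟨k, hk⟩
    induction k generalizing u with
    | zero => exact Or.inl hk
    | succ k ih =>
      have h1 := ih (par u) hk
      have h2 : par u ∈ S := by
        rcases h1 with h1 | ⟨h1, _⟩
        · exact h1 ▸ hv
        · exact hLS _ h1
      have huL : u ∈ L := by
        by_contra huL
        exact parNS u huL h2
      rw [parL u huL] at h1
      have h3 := (hhang u huL).2.2.1
      rcases h1 with h1 | ⟨h1, h1'⟩
      · rcases h3 with h3 | ⟨h3, _⟩
        · exact Or.inr ⟨huL, h3 ▸ h1⟩
        · exact absurd (h1 ▸ h3) hvL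
      · rcases h3 with h3 | ⟨_, h3, _⟩
        · exact absurd (h3 ▸ h1) (hbestL u huL)
        · exact Or.inr ⟨huL, h3 ▸ h1'⟩
  have hangBelow : ∀ n, ∀ l ∈ L, rank l = n → l ∈ below par (best l) := by
    intro n
    induction n using Nat.strong_induction_on with
    | _ n ihn =>
      intro l hl hn
      refine mem_below_of_parent ?_
      rw [parL l hl]
      rcases (hhang l hl).2.2.1 with h | ⟨h1, h2, h3⟩
      · exact h ▸ self_mem_below _ _
      · exact h2 ▸ ihn _ (hn ▸ h3) _ h1 rfl
  have belowK : ∀ v, v ∉ S → v ≠ a → ∀ u ∈ below par v, u = v ∨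
      ∃ s ∈ S, s ∉ L ∧ ¬ G.Adj s a ∧ w s = v ∧ (u = s ∨ (u ∈ L ∧ best u = s)) := by
    rintro v hv hva u ⟨k, hk⟩
    by_cases huv : u = v
    · exact Or.inl huv
    · right
      induction k generalizing u with
      | zero => exact absurd hk huv
      | succ k ih =>
        by_cases hpu : par u = v
        · have huL : u ∉ L := by
            intro huL
            rw [parL u huL] at hpu
            rcases (hhang u huL).2.2.1 with h | ⟨h, _⟩
            · exact hv (hpu ▸ h ▸ hbestS u huL)
            · exact hv (hpu ▸ hLS _ h)
          have huS : u ∈ S := by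
            by_contra huS
            exact hva (hpu ▸ parK u huS)
          have hua : ¬ G.Adj u a := fun h => hva (hpu ▸ parA u huS huL h)
          exact ⟨u, huS, huL, hua, parW u huS huL hua ▸ hpu, Or.inl rfl⟩
        · obtain ⟨s, hs, hsL, hsa, hsv, h⟩ := ih (par u) hk hpu
          have h0 : par u ∈ below par s := by
            rcases h with h | ⟨h, h'⟩
            · exact ⟨0, h⟩
            · exact h' ▸ hangBelow _ _ h rfl
          exact ⟨s, hs, hsL, hsa, hsv, belowS s hs hsL u (mem_below_of_parent h0)⟩
  -- the numbers of edges at the vertices of the different kinds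
  have nK : ∀ (X : Set V) (x : V), {y | G.Adj x y ∧ y ∉ X}.ncard ≤ #Sᶜ - 1 + #S := by
    intro X x
    have h1 : {y | G.Adj x y ∧ y ∉ X} ⊆ ((univ.erase x : Finset V) : Set V) := by
      rintro y ⟨h, _⟩
      simp [h.ne']
    have h2 := Set.ncard_le_ncard h1 (finite_toSet _)
    rw [Set.ncard_coe_finset, card_erase_of_mem (mem_univ x), card_univ] at h2
    have := card_compl_add_card S
    omega
  have nS : ∀ (X : Set V) (x : V), {y | G.Adj x y ∧ y ∉ X}.ncard ≤ #(t x) + #S := by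
    intro X x
    have h1 : {y | G.Adj x y ∧ y ∉ X} ⊆ ((t x ∪ S : Finset V) : Set V) := by
      rintro y ⟨h, _⟩
      by_cases hy : y ∈ S
      · simp [hy]
      · simp [ht, h, hy]
    have h2 := Set.ncard_le_ncard h1 (finite_toSet _)
    rw [Set.ncard_coe_finset] at h2
    exact h2.trans (card_union_le _ _)
  have nL : ∀ l ∈ L, #(t l) = 0 := fun l hl => card_eq_zero.2 ((hL l).1 hl).2
  have tle : ∀ s, #(t s) ≤ #Sᶜ := fun s => by
    have := htm s
    omega
  have cardL : #L ≤ #S := card_le_card fun l hl => hLS l hl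
  have sumL : ∑ x ∈ L, (#(t x) + #S) ≤ #S * #S := by
    calc _ ≤ ∑ x ∈ L, #S := sum_le_sum fun l hl => by rw [nL l hl, zero_add]
      _ ≤ _ := by
        rw [sum_const, smul_eq_mul]
        exact Nat.mul_le_mul_right _ cardL
  have hqq : #S ≤ #S * #S := Nat.le_mul_self _
  refine le_trans (Nat.add_le_add_right ((stc_le hpar.isSpanningTree).trans
    (hpar.treeCongestion_le (k := 2 * #Sᶜ - 5) fun v hv => ?_)) 5) (by omega)
  by_cases hvS : v ∈ S
  · by_cases hvL : v ∈ L
    · have := ncard_cutPairs_le_sum G (below par v) L (belowL v hvL) _ fun x _ => nS _ x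
      omega
    · have := ncard_cutPairs_le_sum G (below par v) (insert v L) (fun u hu => by
        rcases belowS v hvS hvL u hu with h | h
        · simp [h]
        · simp [h.1]) _ fun x _ => nS _ x
      rw [sum_insert hvL] at this
      have := tle v
      omega
  · by_cases hbig : ∃ s ∈ S, s ∉ L ∧ ¬ G.Adj s a ∧ w s = v ∧ 2 * #S < #(t s)
    · obtain ⟨s, hs, hsL, hsa, hsv, hsbig⟩ := hbig
      have hsub : ∀ u ∈ below par v, u = v ∨ u = s ∨ (u ∈ L ∧ best u = s) := by
        intro u hu
        rcases belowK v hvS hv u hu with h | ⟨s', hs', _, _, hsv', h⟩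
        · exact Or.inl h
        · have : s' = s := by
            by_contra hne
            exact hw' s hs hsbig s' hs' hne (hsv'.trans hsv.symm)
          exact Or.inr (this ▸ h)
      have hsbelow : s ∈ below par v := ⟨1, (parW s hs hsL hsa).trans hsv⟩
      let E := #{s' ∈ S | ¬ G.Adj s' a ∧ missing G S s' ≤ missing G S s}
      let C := {l ∈ L | best l = s}
      have hC : ∀ l ∈ C, l ∈ L ∧ best l = s := fun l hl => mem_filter.1 hl
      -- the neighbours of a descendant of `s` are descendants, or good for hanging it on them
      have nC : ∀ l ∈ C, {y | G.Adj l y ∧ y ∉ below par v}.ncard ≤ E := by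
        intro l hl
        obtain ⟨hlL, hls⟩ := hC l hl
        have h1 : {y | G.Adj l y ∧ y ∉ below par v} ⊆
            (({s' ∈ S | ¬ G.Adj s' a ∧ missing G S s' ≤ missing G S s} : Finset V) : Set V) := by
          rintro y ⟨hly, hy⟩
          have hyL : y ∉ L := by
            intro hyL
            have hb : best y = s := ((hhang l hlL).2.2.2.2.1 y hyL hly).trans hls
            exact hy (below_trans (hb ▸ hangBelow _ y hyL rfl) hsbelow)
          have hμ := (hhang l hlL).2.2.2.2.2 y hyL hly
          rw [hls] at hμ
          have hμs : μ s = missing G S s := if_neg hsa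
          have hms := htm s
          have hya : ¬ G.Adj y a := by
            intro hya
            have : μ y = #Sᶜ + 1 := if_pos hya
            omega
          have hμy : μ y = missing G S y := if_neg hya
          rw [mem_coe, mem_filter]
          exact ⟨hLk l hlL y hly, hya, by omega⟩
        have h2 := Set.ncard_le_ncard h1 (finite_toSet _)
        rwa [Set.ncard_coe_finset] at h2
      let c : V → ℕ := fun x => if x = v then #Sᶜ - 1 + #S else if x = s then #(t s) + #S else E
      have hvs : s ≠ v := fun h => hvS (h ▸ hs)
      have hvC : v ∉ insert s C := by
        rw [mem_insert, not_or]
        exact ⟨hvs.symm, fun h => hvS (hLS v (hC v h).1)⟩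
      have hsC : s ∉ C := fun h => hsL (hC s h).1
      have := ncard_cutPairs_le_sum G (below par v) (insert v (insert s C)) (fun u hu => by
        rcases hsub u hu with h | h | h
        · simp [h]
        · simp [h]
        · simp [C, h.1, h.2]) c (fun x hx => by
          rcases hsub x hx with h | h | h
          · rw [h]
            simp only [c, if_true]
            exact nK _ v
          · rw [h]
            simp only [c, hvs, if_true, if_false]
            exact nS _ s
          · have h1 : x ≠ v := fun e => hvS (e ▸ hLS x h.1)
            have h2 : x ≠ s := fun e => hsL (e ▸ h.1)
            simp only [c, h1, h2, if_false]
            exact nC x (mem_filter.2 h))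
      rw [sum_insert hvC, sum_insert hsC] at this
      have hsumC : ∑ x ∈ C, c x ≤ #S * E := by
        calc _ ≤ ∑ x ∈ C, E := by
              refine sum_le_sum fun x hx => ?_
              have h1 : x ≠ v := fun e => hvS (e ▸ hLS x (hC x hx).1)
              have h2 : x ≠ s := fun e => hsL (e ▸ (hC x hx).1)
              simp [c, h1, h2]
          _ ≤ _ := by
            rw [sum_const, smul_eq_mul]
            exact Nat.mul_le_mul_right _ ((card_filter_le _ _).trans cardL)
      have c1 : c v = #Sᶜ - 1 + #S := if_pos rfl
      have c2 : c s = #(t s) + #S := by simp [c, hvs]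
      have harith := congestion_arith (card_pos.2 ⟨s, hs⟩) hm
        (card_pos.2 ⟨s, by simp [hs, hsa]⟩) (ha s hs hsa)
      have hms := htm s
      change 2 * #S + #S * E + 4 ≤ _ at harith
      omega
    · let C := {s ∈ S | #(t s) ≤ 2 * #S}
      let c : V → ℕ := fun x => if x = v then #Sᶜ - 1 + #S else #(t x) + #S
      have hvC : v ∉ C := fun h => hvS (mem_filter.1 h).1
      have := ncard_cutPairs_le_sum G (below par v) (insert v C) (fun u hu => by
        rcases belowK v hvS hv u hu with h | ⟨s, hs, hsL, hsa, hsv, h | h⟩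
        · simp [h]
        · have : #(t s) ≤ 2 * #S := by
            by_contra hlt
            exact hbig ⟨s, hs, hsL, hsa, hsv, not_le.1 hlt⟩
          simp [C, h, hs, this]
        · simp [C, hLS u h.1, nL u h.1]) c (fun x _ => by
          by_cases h : x = v
          · simp only [c, h, if_true]
            exact nK _ v
          · simp only [c, h, if_false]
            exact nS _ x)
      rw [sum_insert hvC] at this
      have c1 : c v = #Sᶜ - 1 + #S := if_pos rfl
      have hsumC : ∑ x ∈ C, c x ≤ #S * (3 * #S) := by
        calc _ ≤ ∑ x ∈ C, 3 * #S := by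
              refine sum_le_sum fun x hx => ?_
              have h1 : x ≠ v := fun e => hvC (e ▸ hx)
              have h2 := (mem_filter.1 hx).2
              simp only [c, h1, if_false]
              omega
          _ ≤ _ := by
            rw [sum_const, smul_eq_mul]
            exact Nat.mul_le_mul_right _ (card_filter_le _ _)
      have h3 : #S * (3 * #S) = 3 * (#S * #S) := by ring
      omega

/-! ### Optimal trees are described by short lists -/

theorem IsParentMap.notMem_below_of_mem {V : Type*} {G : SimpleGraph V} {r : V} {par : V → V}
    (h : IsParentMap G r par) {u v : V} (hu : u ∈ below par v) (hne : u ≠ v) :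
    v ∉ below par u := by
  intro hv
  by_cases hvr : v = r
  · subst hvr
    exact h.root_notMem_below hne hv
  · exact h.parent_notMem_below hvr (below_trans (parent_mem_below hv hne.symm) hu)

open scoped Classical in
/-- The vertices of the clique outside of `S` which are descendants of `v`. -/
noncomputable def cliqueBelow (S : Finset V) (par : V → V) (v : V) : Finset V :=
  {k ∈ Sᶜ | k ∈ below par v}

theorem mem_cliqueBelow {par : V → V} {v k : V} :
    k ∈ cliqueBelow S par v ↔ k ∉ S ∧ k ∈ below par v := by
  simp [cliqueBelow]

theorem cliqueBelow_subset (S : Finset V) (par : V → V) (v : V) : cliqueBelow S par v ⊆ Sᶜ := by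
  classical exact filter_subset _ _

/-- The cut above `v` contains all edges of the clique between its two sides. -/
theorem card_mul_le_cut (hK : G.IsClique {v | v ∉ S}) (par : V → V) (v : V) :
    #(cliqueBelow S par v) * (#Sᶜ - #(cliqueBelow S par v)) ≤ (cutPairs G (below par v)).ncard := by
  rw [← card_sdiff_of_subset (cliqueBelow_subset _ _ _), ← card_product, ← Set.ncard_coe_finset]
  refine Set.ncard_le_ncard ?_
  rintro ⟨x, y⟩ hxy
  obtain ⟨hx, hy⟩ := mem_product.1 (mem_coe.1 hxy)
  obtain ⟨hxS, hxb⟩ := mem_cliqueBelow.1 hx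
  have hyS : y ∉ S := mem_compl.1 (mem_sdiff.1 hy).1
  have hyb : y ∉ below par v := fun h => (mem_sdiff.1 hy).2 (mem_cliqueBelow.2 ⟨hyS, h⟩)
  have hne : x ≠ y := fun h => hyb (h ▸ hxb)
  exact ⟨hK hxS hyS hne, hxb, hyb⟩

/-- A cut of a clique with fewer than `2 * (m - 2)` edges has a side with at most one vertex. -/
theorem le_one_of_mul_le {x m k : ℕ} (h : x * (m - x) ≤ k) (hk : k + 5 ≤ 2 * m) :
    x ≤ 1 ∨ m ≤ x + 1 := by
  by_contra! hcon
  obtain ⟨y, rfl⟩ : ∃ y, m = x + (y + 2) := ⟨m - x - 2, by omega⟩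
  obtain ⟨z, rfl⟩ : ∃ z, x = z + 2 := ⟨x - 2, by omega⟩
  rw [Nat.add_sub_cancel_left] at h
  nlinarith [Nat.zero_le (z * y)]

open scoped Classical in
/-- There is an optimal tree which, rooted suitably, is determined by one vertex `hub` and a list
of `O(#S ^ 2)` vertices with their parents: `hub` is the parent of all other vertices.

If the clique is large, then every edge of an optimal tree separates at most one vertex of the
clique from the others. The vertex `hub` is chosen as deep as possible such that almost all of the
clique lies below it; then the subtrees below `hub` contain at most one vertex of the clique each,
and a vertex of the clique whose parent is in `S` is determined by its parent. -/
theorem exists_short_description (hG : G.Connected) (hK : G.IsClique {v | v ∉ S}) :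
    ∃ (r hub : V) (par : V → V) (A : Finset V), IsParentMap G r par ∧
      treeCongestion G (parentGraph r par) = stc G ∧ #A ≤ 11 * (#S * #S + 1) ∧
      ∀ v ∉ A, par v = hub := by
  obtain ⟨r⟩ := hG.nonempty
  obtain ⟨T, hT, hopt⟩ := exists_optimal hG
  obtain ⟨par, hpar, rfl⟩ := hT.exists_parentMap r
  have hqq : #S ≤ #S * #S := Nat.le_mul_self _
  by_cases hm : 10 * (#S * #S + 1) ≤ #Sᶜ
  swap
  · refine ⟨r, r, par, univ, hpar, hopt, ?_, fun v hv => absurd (mem_univ v) hv⟩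
    rw [card_univ, ← card_compl_add_card S]
    omega
  have hup := stc_le_of_large_clique hG hK hm
  have hsmall : ∀ v, v ≠ r →
      #(cliqueBelow S par v) ≤ 1 ∨ #Sᶜ ≤ #(cliqueBelow S par v) + 1 := fun v hv =>
    le_one_of_mul_le ((card_mul_le_cut hK par v).trans (hpar.cut_le_treeCongestion hv))
      (hopt ▸ hup)
  have hroot : cliqueBelow S par r = Sᶜ := by
    ext k
    simp [mem_cliqueBelow, hpar.mem_below_root k]
  -- the vertex `hub`
  let F : Finset V := {v | 2 ≤ #(cliqueBelow S par v)}
  have hF : F.Nonempty := ⟨r, by simp only [F, mem_filter, mem_univ, true_and, hroot]; omega⟩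
  obtain ⟨h, hhF, hmin⟩ := exists_min_image F (fun v => (below par v).ncard) hF
  have hh : 2 ≤ #(cliqueBelow S par h) := (mem_filter.1 hhF).2
  have hout : #(Sᶜ \ cliqueBelow S par h) ≤ 1 := by
    rw [card_sdiff_of_subset (cliqueBelow_subset _ _ _)]
    by_cases hr : h = r
    · rw [hr, hroot]
      omega
    · have := hsmall h hr
      omega
  let B : Finset V := {v ∈ cliqueBelow S par h | v ≠ h ∧ par v ≠ h}
  have hB : ∀ v ∈ B, #(cliqueBelow S par (par v)) ≤ 1 ∧ v ∈ cliqueBelow S par (par v) ∧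
      par v ∈ S := by
    intro v hv
    obtain ⟨hv1, hvh, hpv⟩ := mem_filter.1 hv
    obtain ⟨hvS, hvb⟩ := mem_cliqueBelow.1 hv1
    have hvr : v ≠ r := by
      rintro rfl
      exact hpar.root_notMem_below hvh.symm hvb
    have hpb := parent_mem_below hvb hvh
    have hlt : (below par (par v)).ncard < (below par h).ncard := by
      refine Set.ncard_lt_ncard ⟨fun u hu => below_trans hu hpb, fun hsub => ?_⟩
      exact hpar.notMem_below_of_mem hpb hpv (hsub (self_mem_below par h))
    have h1 : #(cliqueBelow S par (par v)) ≤ 1 := by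
      by_contra hcon
      have := hmin (par v) (by simp only [F, mem_filter, mem_univ, true_and]; omega)
      omega
    have h2 : v ∈ cliqueBelow S par (par v) := mem_cliqueBelow.2 ⟨hvS, 1, rfl⟩
    refine ⟨h1, h2, ?_⟩
    by_contra hpS
    exact hpar.parent_ne hvr (card_le_one.1 h1 _ (mem_cliqueBelow.2
      ⟨hpS, self_mem_below par _⟩) _ h2)
  have hBcard : #B ≤ #S := by
    refine card_le_card_of_injOn par (fun v hv => (hB v hv).2.2) ?_
    intro v hv v' hv' he
    have he' : par v = par v' := he
    exact card_le_one.1 (hB v hv).1 _ (hB v hv).2.1 _ (he' ▸ (hB v' hv').2.1)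
  refine ⟨r, h, par, insert h (S ∪ ((Sᶜ \ cliqueBelow S par h) ∪ B)), hpar, hopt, ?_, ?_⟩
  · have h1 := card_insert_le h (S ∪ ((Sᶜ \ cliqueBelow S par h) ∪ B))
    have h2 := card_union_le S ((Sᶜ \ cliqueBelow S par h) ∪ B)
    have h3 := card_union_le (Sᶜ \ cliqueBelow S par h) B
    omega
  · intro v hv
    simp only [mem_insert, mem_union, mem_sdiff, mem_compl, not_or, not_and, not_not, B,
      mem_filter] at hv
    by_contra hne
    exact hne (hv.2.2.2 (hv.2.2.1 hv.2.1) hv.1)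

/-! ### Exchanging twins -/

omit [Fintype V] in
/-- Exchanging two vertices of the clique with the same neighbours in `S` is an automorphism. -/
theorem swap_adj {u z : V} (hu : u ∉ S) (hz : z ∉ S) (hK : G.IsClique {v | v ∉ S})
    (htw : ∀ s ∈ S, G.Adj u s ↔ G.Adj z s) {x y : V} (hxy : G.Adj x y) :
    G.Adj (Equiv.swap u z x) (Equiv.swap u z y) := by
  have key : ∀ w, w ≠ u → w ≠ z → (G.Adj u w ↔ G.Adj z w) := by
    intro w h1 h2
    by_cases hw : w ∈ S
    · exact htw w hw
    · exact ⟨fun _ => hK hz hw h2.symm, fun _ => hK hu hw h1.symm⟩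
  have hne := hxy.ne
  rcases eq_or_ne x u with rfl | hxu
  · rw [Equiv.swap_apply_left]
    rcases eq_or_ne y z with rfl | hyz
    · rw [Equiv.swap_apply_right]
      exact hxy.symm
    · rw [Equiv.swap_apply_of_ne_of_ne hne.symm hyz]
      exact (key y hne.symm hyz).1 hxy
  · rcases eq_or_ne x z with rfl | hxz
    · rw [Equiv.swap_apply_right]
      rcases eq_or_ne y u with rfl | hyu
      · rw [Equiv.swap_apply_left]
        exact hxy.symm
      · rw [Equiv.swap_apply_of_ne_of_ne hyu hne.symm]
        exact (key y hyu hne.symm).2 hxy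
    · rw [Equiv.swap_apply_of_ne_of_ne hxu hxz]
      rcases eq_or_ne y u with rfl | hyu
      · rw [Equiv.swap_apply_left]
        exact ((key x hxu hxz).1 hxy.symm).symm
      · rcases eq_or_ne y z with rfl | hyz
        · rw [Equiv.swap_apply_right]
          exact ((key x hxu hxz).2 hxy.symm).symm
        · rwa [Equiv.swap_apply_of_ne_of_ne hyu hyz]

omit [Fintype V] in
theorem swap_adj_iff {u z : V} (hu : u ∉ S) (hz : z ∉ S) (hK : G.IsClique {v | v ∉ S})
    (htw : ∀ s ∈ S, G.Adj u s ↔ G.Adj z s) (x y : V) :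
    G.Adj (Equiv.swap u z x) (Equiv.swap u z y) ↔ G.Adj x y := by
  refine ⟨fun h => ?_, swap_adj hu hz hK htw⟩
  have := swap_adj hu hz hK htw h
  rwa [Equiv.swap_apply_self, Equiv.swap_apply_self] at this

open scoped Classical in
/-- If `Q` contains `S` and, for every vertex outside of `Q`, sufficiently many of its twins, then
every small set `W` can be moved into `Q` by an automorphism. -/
theorem exists_automorphism (hK : G.IsClique {v | v ∉ S}) {Q : Finset V} {M : ℕ}
    (hQ : ∀ u ∉ Q, u ∉ S ∧ M ≤ #{z ∈ Q | z ∉ S ∧ ∀ s ∈ S, G.Adj u s ↔ G.Adj z s})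
    (W : Finset V) (hW : #W ≤ M) :
    ∃ σ : Equiv.Perm V, (∀ x y, G.Adj (σ x) (σ y) ↔ G.Adj x y) ∧ ∀ w ∈ W, σ w ∈ Q := by
  suffices H : ∀ (k : ℕ) (σ : Equiv.Perm V), (∀ x y, G.Adj (σ x) (σ y) ↔ G.Adj x y) →
      #{w ∈ W | σ w ∉ Q} = k →
      ∃ σ : Equiv.Perm V, (∀ x y, G.Adj (σ x) (σ y) ↔ G.Adj x y) ∧ ∀ w ∈ W, σ w ∈ Q from
    H _ 1 (fun _ _ => Iff.rfl) rfl
  intro k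
  induction k with
  | zero =>
    intro σ hσ h
    refine ⟨σ, hσ, fun w hw => ?_⟩
    by_contra hcon
    exact notMem_empty w (card_eq_zero.1 h ▸ mem_filter.2 ⟨hw, hcon⟩)
  | succ k ih =>
    intro σ hσ h
    obtain ⟨w, hw⟩ := card_pos.1 (show 0 < #{w ∈ W | σ w ∉ Q} by omega)
    obtain ⟨hwW, hwQ⟩ := mem_filter.1 hw
    obtain ⟨hwS, hM⟩ := hQ _ hwQ
    -- a twin of `σ w` in `Q` which is not yet used
    obtain ⟨z, hz, hzW⟩ : ∃ z ∈ ({z ∈ Q | z ∉ S ∧ ∀ s ∈ S, G.Adj (σ w) s ↔ G.Adj z s} : Finset V),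
        z ∉ (W.erase w).image σ := by
      refine exists_mem_notMem_of_card_lt_card (lt_of_lt_of_le ?_ hM)
      have h1 := card_image_le (s := W.erase w) (f := σ)
      have h2 := card_erase_lt_of_mem hwW
      omega
    obtain ⟨hzQ, hzS, htw⟩ := mem_filter.1 hz
    let τ : Equiv.Perm V := σ.trans (Equiv.swap (σ w) z)
    have hτw : τ w = z := by simp [τ]
    have hτ : ∀ w' ∈ W, w' ≠ w → τ w' = σ w' := by
      intro w' hw' hne
      have h1 : σ w' ≠ σ w := fun e => hne (σ.injective e)
      have h2 : σ w' ≠ z := fun e => hzW (e ▸ mem_image_of_mem σ (mem_erase.2 ⟨hne, hw'⟩))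
      simp [τ, Equiv.swap_apply_of_ne_of_ne h1 h2]
    refine ih τ (fun x y => (swap_adj_iff hwS hzS hK htw _ _).trans (hσ x y)) ?_
    have : ({w ∈ W | τ w ∉ Q} : Finset V) = ({w ∈ W | σ w ∉ Q} : Finset V).erase w := by
      ext x
      simp only [mem_filter, mem_erase]
      constructor
      · rintro ⟨h1, h2⟩
        have hxw : x ≠ w := by
          rintro rfl
          exact h2 (hτw ▸ hzQ)
        exact ⟨hxw, h1, hτ x h1 hxw ▸ h2⟩
      · rintro ⟨h1, h2, h3⟩
        exact ⟨h2, (hτ x h2 h1).symm ▸ h3⟩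
    rw [this, card_erase_of_mem hw, h]
    rfl

omit [Fintype V] [DecidableEq V] in
theorem iterate_conj (par : V → V) (σ : Equiv.Perm V) (k : ℕ) (v : V) :
    (fun v => σ (par (σ.symm v)))^[k] v = σ (par^[k] (σ.symm v)) := by
  induction k generalizing v with
  | zero => simp
  | succ k ih =>
    rw [Function.iterate_succ_apply, ih, Function.iterate_succ_apply, Equiv.symm_apply_apply]

omit [Fintype V] [DecidableEq V] in
theorem IsParentMap.map {r : V} {par : V → V} (h : IsParentMap G r par) (σ : Equiv.Perm V)
    (hσ : ∀ x y, G.Adj (σ x) (σ y) ↔ G.Adj x y) :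
    IsParentMap G (σ r) fun v => σ (par (σ.symm v)) := by
  refine ⟨by simp [h.root], fun v hv => ?_, fun v => ?_⟩
  · have := (hσ _ _).2 (h.adj (σ.symm v) fun e => hv (by rw [← e, Equiv.apply_symm_apply]))
    rwa [Equiv.apply_symm_apply] at this
  · obtain ⟨k, hk⟩ := h.reach (σ.symm v)
    exact ⟨k, by rw [iterate_conj, hk]⟩

omit [DecidableEq V] in
/-- An automorphism maps an optimal tree to an optimal tree. -/
theorem IsParentMap.map_optimal {r : V} {par : V → V} (h : IsParentMap G r par)
    (hopt : treeCongestion G (parentGraph r par) = stc G) (σ : Equiv.Perm V)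
    (hσ : ∀ x y, G.Adj (σ x) (σ y) ↔ G.Adj x y) :
    treeCongestion G (parentGraph (σ r) fun v => σ (par (σ.symm v))) = stc G := by
  refine le_antisymm ?_ (stc_le (h.map σ hσ).isSpanningTree)
  rw [← hopt]
  refine (h.map σ hσ).treeCongestion_le fun v hv => ?_
  refine le_trans ?_ (h.cut_le_treeCongestion (v := σ.symm v) fun e => hv (by
    rw [← e, Equiv.apply_symm_apply]))
  have hb : ∀ u, u ∈ below (fun v => σ (par (σ.symm v))) v ↔ σ.symm u ∈ below par (σ.symm v) := by
    intro u
    refine exists_congr fun k => ?_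
    rw [iterate_conj, Equiv.eq_symm_apply]
  refine Set.ncard_le_ncard_of_injOn (fun e => (σ.symm e.1, σ.symm e.2)) ?_ ?_
  · rintro ⟨x, y⟩ ⟨h1, h2, h3⟩
    refine ⟨?_, (hb x).1 h2, fun hy => h3 ((hb y).2 hy)⟩
    rw [← hσ, Equiv.apply_symm_apply, Equiv.apply_symm_apply]
    exact h1
  · rintro ⟨x, y⟩ _ ⟨x', y'⟩ _ he
    exact Prod.ext (σ.symm.injective (Prod.mk.inj he).1) (σ.symm.injective (Prod.mk.inj he).2)

end CliqueGraph

/-! ### Meaning of the quantities computed on an input -/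

/-- The root is reached from every vertex in as many steps as there are vertices. -/
theorem IsParentMap.iterate_card {V : Type*} [Finite V] {G : SimpleGraph V} {r : V} {par : V → V}
    (h : IsParentMap G r par) (v : V) : par^[Nat.card V] v = r := by
  -- the number of descendants grows along the path to the root
  have key : ∀ k, par^[k] v = r ∨ k + 1 ≤ (below par (par^[k] v)).ncard := by
    intro k
    induction k with
    | zero => exact Or.inr ((Set.ncard_pos (Set.toFinite _)).2 ⟨v, self_mem_below par v⟩)
    | succ k ih =>
      rw [Function.iterate_succ_apply']
      rcases ih with ih | ih
      · exact Or.inl (by rw [ih, h.root])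
      · by_cases hr : par^[k] v = r
        · exact Or.inl (by rw [hr, h.root])
        · right
          have hlt : (below par (par^[k] v)).ncard < (below par (par (par^[k] v))).ncard := by
            refine Set.ncard_lt_ncard ⟨fun u hu => below_trans hu ⟨1, rfl⟩, fun hsub => ?_⟩
            exact h.parent_notMem_below hr (hsub (self_mem_below par _))
          omega
  rcases key (Nat.card V) with h1 | h1
  · exact h1
  · have := Set.ncard_le_card (below par (par^[Nat.card V] v))
    omega

section Input

variable {n : ℕ} {G : SimpleGraph (Fin n)} {S : Finset (Fin n)}

theorem inputState_size (G : SimpleGraph (Fin n)) (S : Finset (Fin n)) :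
    (inputState G S).var 0 = n := rfl

theorem mul_add_inj {u v u' v' : Fin n} (h : n * (u : ℕ) + v = n * (u' : ℕ) + v') :
    u = u' ∧ v = v' := by
  have hn : 0 < n := u.pos
  have h1 := congrArg (· / n) h
  have h2 := congrArg (· % n) h
  simp only [Nat.mul_add_div hn, Nat.div_eq_of_lt v.2,
    Nat.div_eq_of_lt v'.2, add_zero] at h1
  simp only [Nat.mul_add_mod, Nat.mod_eq_of_lt v.2, Nat.mod_eq_of_lt v'.2] at h2
  exact ⟨Fin.ext h1, Fin.ext h2⟩

theorem edge_iff (u v : Fin n) : Edge (inputState G S) u v ↔ G.Adj u v := by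
  change adjArray G (u * n + v) ≠ 0 ↔ _
  rw [adjArray, mul_comm (u : ℕ) n]
  constructor
  · intro h
    by_contra hcon
    refine h (if_neg ?_)
    rintro ⟨u', v', he, hadj⟩
    obtain ⟨rfl, rfl⟩ := mul_add_inj he
    exact hcon hadj
  · intro h
    rw [if_pos ⟨u, v, rfl, h⟩]
    exact one_ne_zero

theorem inS_iff (v : Fin n) : InS (inputState G S) v ↔ v ∈ S := by
  change setArray S v ≠ 0 ↔ _
  rw [setArray]
  constructor
  · intro h
    by_contra hcon
    refine h (if_neg ?_)
    rintro ⟨v', hv', he⟩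
    exact hcon (Fin.ext he ▸ hv')
  · intro h
    rw [if_pos ⟨v, h, rfl⟩]
    exact one_ne_zero

theorem sum_range_ite_eq_card (p : ℕ → Prop) [DecidablePred p] :
    (∑ u ∈ range n, if p u then 1 else 0) = #{u : Fin n | p u} := by
  rw [sum_range, sum_boole]
  rfl

theorem sizeS_inputState : sizeS (inputState G S) = #S := by
  classical
  rw [sizeS, inputState_size, sum_range_ite_eq_card]
  congr 1
  ext v
  simp [inS_iff]

theorem twin_iff (u v : Fin n) :
    Twin (inputState G S) u v ↔ ∀ s ∈ S, G.Adj u s ↔ G.Adj v s := by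
  rw [Twin, inputState_size]
  constructor
  · intro h s hs
    have := h s s.2 ((inS_iff s).2 hs)
    rwa [edge_iff, edge_iff] at this
  · intro h s hs hsS
    have := h ⟨s, hs⟩ ((inS_iff ⟨s, hs⟩).1 hsS)
    rwa [← edge_iff (S := S), ← edge_iff (S := S)] at this

open scoped Classical in
/-- The twins of `v` outside of `S` which precede `v`. -/
noncomputable def earlierTwins (G : SimpleGraph (Fin n)) (S : Finset (Fin n)) (v : Fin n) :
    Finset (Fin n) :=
  {u | u < v ∧ u ∉ S ∧ ∀ s ∈ S, G.Adj u s ↔ G.Adj v s}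

open scoped Classical in
/-- The pool, as a set of vertices of the input graph. -/
noncomputable def pool (G : SimpleGraph (Fin n)) (S : Finset (Fin n)) : Finset (Fin n) :=
  {v | Pool (inputState G S) v}

theorem mem_pool {v : Fin n} : v ∈ pool G S ↔ Pool (inputState G S) v := by
  simp [pool]

theorem mem_pool_iff {v : Fin n} :
    v ∈ pool G S ↔ v ∈ S ∨ #(earlierTwins G S v) < numDigits (inputState G S) := by
  classical
  rw [mem_pool, Pool, inS_iff, inputState_size, sum_range_ite_eq_card, numDigits, earlierTwins]
  simp only [inS_iff, twin_iff, Fin.val_fin_lt]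

theorem poolSize_eq : poolSize (inputState G S) = #(pool G S) := by
  classical
  rw [poolSize, inputState_size, sum_range_ite_eq_card, pool]

open scoped Classical in
/-- A class of twins which is not contained in the pool has many elements in the pool. -/
theorem many_twins_in_pool {u : Fin n} (hu : u ∉ pool G S) :
    u ∉ S ∧ numDigits (inputState G S) ≤
      #{z ∈ pool G S | z ∉ S ∧ ∀ s ∈ S, G.Adj u s ↔ G.Adj z s} := by
  have huS : u ∉ S := fun h => hu (mem_pool_iff.2 (Or.inl h))
  refine ⟨huS, ?_⟩
  -- all predecessors of the first twin outside of the pool are in the pool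
  let C : Finset (Fin n) := {z | z ∉ pool G S ∧ ∀ s ∈ S, G.Adj u s ↔ G.Adj z s}
  have hC : C.Nonempty := ⟨u, by simp [C, hu]⟩
  obtain ⟨hv1, hv2⟩ : C.min' hC ∉ pool G S ∧ ∀ s ∈ S, G.Adj u s ↔ G.Adj (C.min' hC) s := by
    have := C.min'_mem hC
    simpa only [C, mem_filter, mem_univ, true_and] using this
  have hv3 : numDigits (inputState G S) ≤ #(earlierTwins G S (C.min' hC)) := by
    by_contra hcon
    exact hv1 (mem_pool_iff.2 (Or.inr (not_le.1 hcon)))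
  refine hv3.trans (card_le_card fun z hz => ?_)
  simp only [earlierTwins, mem_filter, mem_univ, true_and] at hz
  have htw : ∀ s ∈ S, G.Adj u s ↔ G.Adj z s := fun s hs => (hv2 s hs).trans (hz.2.2 s hs).symm
  refine mem_filter.2 ⟨?_, hz.2.1, htw⟩
  by_contra hzQ
  exact absurd (C.min'_le z (by simp only [C, mem_filter, mem_univ, true_and]; exact ⟨hzQ, htw⟩))
    (not_le.2 hz.1)

/-- The pool contains at most `numDigits` vertices of each of the `2 ^ #S` classes. -/
theorem card_pool_le : #(pool G S) ≤ #S + numDigits (inputState G S) * 2 ^ #S := by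
  classical
  set M := numDigits (inputState G S) with hM
  have h1 : #(pool G S \ S) ≤ M * #S.powerset := by
    refine card_le_mul_card_image_of_maps_to (f := fun v => {s ∈ S | G.Adj v s})
      (fun v _ => mem_powerset.2 (filter_subset _ _)) M fun B _ => ?_
    rcases ({v ∈ pool G S \ S | ({s ∈ S | G.Adj v s} : Finset (Fin n)) = B} :
      Finset (Fin n)).eq_empty_or_nonempty with h0 | h0
    · simp [h0]
    · set F : Finset (Fin n) := {v ∈ pool G S \ S | ({s ∈ S | G.Adj v s} : Finset (Fin n)) = B}
      have hmemF : ∀ v, v ∈ F ↔ (v ∈ pool G S ∧ v ∉ S) ∧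
          ({s ∈ S | G.Adj v s} : Finset (Fin n)) = B := fun v => by
        rw [mem_filter, mem_sdiff]
      have hz := (hmemF _).1 (F.max'_mem h0)
      have hlt : #(earlierTwins G S (F.max' h0)) < M := by
        rcases mem_pool_iff.1 hz.1.1 with h | h
        · exact absurd h hz.1.2
        · exact h
      have hsub : F.erase (F.max' h0) ⊆ earlierTwins G S (F.max' h0) := by
        intro v hv
        obtain ⟨hne, hvF⟩ := mem_erase.1 hv
        have hv' := (hmemF v).1 hvF
        simp only [earlierTwins, mem_filter, mem_univ, true_and]
        refine ⟨lt_of_le_of_ne (F.le_max' v hvF) hne, hv'.1.2, fun s hs => ?_⟩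
        have := Finset.ext_iff.1 (hv'.2.trans hz.2.symm) s
        simpa [hs] using this
      have := card_le_card hsub
      rw [card_erase_of_mem (F.max'_mem h0)] at this
      omega
  rw [card_powerset] at h1
  have h2 : #(pool G S) ≤ #(pool G S \ S) + #S := by
    have := le_card_sdiff S (pool G S)
    omega
  omega

theorem poolElt_lt (hn : 0 < n) (j : ℕ) : poolElt (inputState G S) j < n := by
  classical
  rw [poolElt, inputState_size]
  have : ∀ k ≤ n, iter 0 (fun v x => if Pool (inputState G S) v ∧
      poolRank (inputState G S) v = j then v else x) k < n := by
    intro k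
    induction k with
    | zero => exact fun _ => hn
    | succ k ih =>
      intro hk
      rw [iter]
      split_ifs
      · exact hk
      · exact ih (by omega)
  exact this n le_rfl

/-- A search loop returns a solution if there is a unique one. -/
theorem iter_find {p : ℕ → Prop} [DecidablePred p] {x N v : ℕ} (hv : v < N) (hp : p v)
    (hu : ∀ u, p u → u = v) : iter x (fun u y => if p u then u else y) N = v := by
  have : ∀ k, v < k → iter x (fun u y => if p u then u else y) k = v := by
    intro k
    induction k with
    | zero => intro h; omega
    | succ k ih =>
      intro h
      rw [iter]
      split_ifs with hk
      · exact hu k hk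
      · refine ih (lt_of_le_of_ne (Nat.lt_succ_iff.1 h) ?_)
        rintro rfl
        exact hk hp
  exact this N hv

theorem exists_poolElt {v : Fin n} (hv : v ∈ pool G S) :
    ∃ i < poolSize (inputState G S), poolElt (inputState G S) i = v := by
  classical
  set a := inputState G S with ha
  have hvP : Pool a v := mem_pool.1 hv
  have hrank : ∀ u, poolRank a u = #{w ∈ range n | w < u ∧ Pool a w} := fun u => by
    rw [poolRank, sum_boole]
    rfl
  have hsize : poolSize a = #{w ∈ range n | Pool a w} := by
    rw [poolSize, sum_boole]
    rfl
  have hlt : ∀ u w, Pool a u → u < n → u < w → poolRank a u < poolRank a w := by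
    intro u w hu hun huw
    rw [hrank, hrank]
    refine card_lt_card ⟨fun x hx => ?_, fun h => ?_⟩
    · rw [mem_filter] at hx ⊢
      exact ⟨hx.1, by omega, hx.2.2⟩
    · have := h (mem_filter.2 ⟨mem_range.2 hun, huw, hu⟩)
      rw [mem_filter] at this
      omega
  refine ⟨poolRank a v, ?_, ?_⟩
  · rw [hrank, hsize]
    refine card_lt_card ⟨fun x hx => ?_, fun h => ?_⟩
    · rw [mem_filter] at hx ⊢
      exact ⟨hx.1, hx.2.2⟩
    · have := h (mem_filter.2 ⟨mem_range.2 v.2, hvP⟩)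
      rw [mem_filter] at this
      omega
  · refine iter_find v.2 ⟨hvP, rfl⟩ ?_
    rintro u ⟨hu, he⟩
    by_contra hne
    rcases lt_or_gt_of_ne hne with h | h
    · have := hlt u v hu (h.trans v.2) h
      omega
    · have := hlt v u hvP v.2 h
      omega

/-! ### Candidates and the trees they describe -/

theorem candVertex_lt (hn : 0 < n) (x j : ℕ) : candVertex (inputState G S) x j < n :=
  poolElt_lt hn _

theorem candParent_lt (hn : 0 < n) (x : ℕ) {v : ℕ} (hv : v < n) :
    candParent (inputState G S) x v < n := by
  rw [candParent]
  split_ifs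
  · exact hv
  · generalize listLen (inputState G S) = N
    induction N with
    | zero => exact candVertex_lt hn x 1
    | succ k ih =>
      rw [iter]
      split_ifs
      · exact candVertex_lt hn x _
      · exact ih

/-- The candidate `x` describes the parent function `par` with root `r`. -/
def Describes (G : SimpleGraph (Fin n)) (S : Finset (Fin n)) (x : ℕ) (r : Fin n)
    (par : Fin n → Fin n) : Prop :=
  candVertex (inputState G S) x 0 = r ∧ ∀ v : Fin n, candParent (inputState G S) x v = par v

theorem exists_describes (hn : 0 < n) (x : ℕ) : ∃ r par, Describes G S x r par :=
  ⟨⟨_, candVertex_lt hn x 0⟩, fun v => ⟨_, candParent_lt hn x v.2⟩, rfl, fun _ => rfl⟩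

namespace Describes

variable {x : ℕ} {r : Fin n} {par : Fin n → Fin n}

theorem ancestor (h : Describes G S x r par) (v : Fin n) (k : ℕ) :
    candAncestor (inputState G S) x v k = (par^[k] v : Fin n) := by
  induction k with
  | zero => rfl
  | succ k ih =>
    rw [Function.iterate_succ_apply', ← h.2, ← ih]
    rfl

theorem valid_iff (h : Describes G S x r par) :
    CandValid (inputState G S) x ↔ IsParentMap G r par := by
  rw [CandValid, inputState_size, h.1]
  constructor
  · rintro ⟨h1, h2⟩
    refine ⟨?_, fun v hv => ?_, fun v => ⟨n, ?_⟩⟩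
    · have := h.2 r
      rw [candParent, h.1, if_pos rfl] at this
      exact Fin.ext this.symm
    · have := h1 v v.2 fun e => hv (Fin.ext e)
      rwa [h.2, edge_iff] at this
    · have := h2 v v.2
      rw [h.ancestor] at this
      exact Fin.ext this
  · intro hp
    refine ⟨fun v hv hne => ?_, fun v hv => ?_⟩
    · have := hp.adj ⟨v, hv⟩ fun e => hne (congrArg Fin.val e)
      rwa [← edge_iff (S := S), ← h.2] at this
    · have := hp.iterate_card ⟨v, hv⟩
      rw [Nat.card_fin] at this
      rw [← this]
      exact h.ancestor ⟨v, hv⟩ n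

theorem below_iff (h : Describes G S x r par) (hp : IsParentMap G r par) {v : Fin n} (hv : v ≠ r)
    (u : Fin n) : CandBelow (inputState G S) x v u ↔ u ∈ below par v := by
  rw [CandBelow, inputState_size]
  constructor
  · rintro ⟨k, _, hk⟩
    rw [h.ancestor] at hk
    exact ⟨k, Fin.ext hk⟩
  · rintro ⟨k, hk⟩
    refine ⟨k, ?_, by rw [h.ancestor, hk]⟩
    -- after `n` steps the root is reached
    by_contra hlt
    obtain ⟨l, rfl⟩ : ∃ l, k = l + n := ⟨k - n, by omega⟩
    have := hp.iterate_card u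
    rw [Nat.card_fin] at this
    rw [Function.iterate_add_apply, this, hp.iterate_root] at hk
    exact hv hk.symm

theorem cut_eq (h : Describes G S x r par) (hp : IsParentMap G r par) {v : Fin n} (hv : v ≠ r) :
    candCut (inputState G S) x v = (cutPairs G (below par v)).ncard := by
  classical
  rw [candCut, inputState_size, sum_range]
  simp only [sum_range, edge_iff, h.below_iff hp hv]
  rw [← Finset.sum_product', sum_boole, Nat.cast_id, ← Set.ncard_coe_finset]
  congr 1
  ext ⟨u, w⟩
  simp [cutPairs]

/-- A loop computing a maximum. -/
theorem iter_max_le_iff {p : ℕ → Prop} [DecidablePred p] {F : ℕ → ℕ} {N k : ℕ} :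
    iter 0 (fun v y => if p v ∧ y < F v then F v else y) N ≤ k ↔ ∀ v < N, p v → F v ≤ k := by
  induction N with
  | zero => simp [iter]
  | succ N ih =>
    rw [iter, Nat.forall_lt_succ_right, ← ih]
    split_ifs with h
    · exact ⟨fun h1 => ⟨(h.2.trans_le h1).le, fun _ => h1⟩, fun h1 => h1.2 h.1⟩
    · exact ⟨fun h1 => ⟨h1, fun hp => (not_lt.1 fun h2 => h ⟨hp, h2⟩).trans h1⟩, fun h1 => h1.1⟩

theorem cost_eq (h : Describes G S x r par) (hp : IsParentMap G r par) :
    candCost (inputState G S) x = treeCongestion G (parentGraph r par) := by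
  classical
  rw [candCost, if_pos (h.valid_iff.2 hp), candCong, inputState_size, h.1]
  refine le_antisymm (iter_max_le_iff.2 fun v hv hne => ?_) (hp.treeCongestion_le fun v hv => ?_)
  · have hne' : (⟨v, hv⟩ : Fin n) ≠ r := fun e => hne (congrArg Fin.val e)
    exact (h.cut_eq hp hne').trans_le (hp.cut_le_treeCongestion hne')
  · rw [← h.cut_eq hp hv]
    exact iter_max_le_iff.1 le_rfl v v.2 fun e => hv (Fin.ext e)

end Describes

theorem treeCongestion_le_sq {r : Fin n} {par : Fin n → Fin n} (hp : IsParentMap G r par) :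
    treeCongestion G (parentGraph r par) ≤ n * n := by
  refine hp.treeCongestion_le fun v _ => ?_
  have := Set.ncard_le_card (cutPairs G (below par v))
  rwa [Nat.card_prod, Nat.card_fin] at this

/-- Every sequence of pool vertices is encoded by a candidate. -/
theorem exists_candVertex (W : ℕ → Fin n) (hW : ∀ j, W j ∈ pool G S) :
    ∃ x < numCand (inputState G S),
      ∀ j < numDigits (inputState G S), candVertex (inputState G S) x j = W j := by
  set a := inputState G S with ha
  choose d hd hd' using fun j => exists_poolElt (hW j)
  let D : Fin (numDigits a) → Fin (poolSize a) := fun j => ⟨d j, hd j⟩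
  refine ⟨finFunctionFinEquiv D, (finFunctionFinEquiv D).2, fun j hj => ?_⟩
  have h1 : finFunctionFinEquiv.symm (finFunctionFinEquiv D) ⟨j, hj⟩ = D ⟨j, hj⟩ := by
    rw [Equiv.symm_apply_apply]
  have h2 : (finFunctionFinEquiv D : ℕ) / poolSize a ^ j % poolSize a = d j :=
    congrArg Fin.val h1
  rw [candVertex, h2]
  exact hd' j

theorem exists_describing {r hub : Fin n} {par : Fin n → Fin n} {A : Finset (Fin n)}
    (hp : IsParentMap G r par) (hA : #A ≤ listLen (inputState G S)) (hhub : ∀ v ∉ A, par v = hub)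
    (hr : r ∈ pool G S) (hh : hub ∈ pool G S) (hAQ : ∀ v ∈ A, v ∈ pool G S ∧ par v ∈ pool G S) :
    ∃ x < numCand (inputState G S), Describes G S x r par := by
  set a := inputState G S with ha
  let e : ℕ → Fin n := fun j => A.toList.getD j r
  have he : ∀ j, e j ∈ pool G S ∧ par (e j) ∈ pool G S := by
    intro j
    by_cases hj : j < A.toList.length
    · have : e j = A.toList[j] := List.getD_eq_getElem _ _ hj
      rw [this]
      exact hAQ _ (mem_toList.1 (List.getElem_mem hj))
    · have : e j = r := List.getD_eq_default _ _ (not_lt.1 hj)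
      rw [this, hp.root]
      exact ⟨hr, hr⟩
  have heA : ∀ v ∈ A, ∃ j < listLen a, e j = v := by
    intro v hv
    obtain ⟨j, hj, hjv⟩ := List.mem_iff_getElem.1 (mem_toList.2 hv)
    refine ⟨j, (length_toList A ▸ hj).trans_le hA, ?_⟩
    rw [← hjv]
    exact List.getD_eq_getElem _ _ hj
  let W : ℕ → Fin n := fun j =>
    if j = 0 then r else if j = 1 then hub else
      if j % 2 = 0 then e (j / 2 - 1) else par (e (j / 2 - 1))
  have hW : ∀ j, W j ∈ pool G S := by
    intro j
    simp only [W]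
    split_ifs
    · exact hr
    · exact hh
    · exact (he _).1
    · exact (he _).2
  obtain ⟨x, hx, hxW⟩ := exists_candVertex W hW
  replace hxW : ∀ j < 2 * listLen a + 2, candVertex a x j = W j := hxW
  have w2 : ∀ j, W (2 * j + 2) = e j := fun j => by
    simp only [W]
    rw [if_neg (by omega), if_neg (by omega), if_pos (by omega),
      show (2 * j + 2) / 2 - 1 = j by omega]
  have w3 : ∀ j, W (2 * j + 3) = par (e j) := fun j => by
    simp only [W]
    rw [if_neg (by omega), if_neg (by omega), if_neg (by omega),
      show (2 * j + 3) / 2 - 1 = j by omega]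
  have x0 : candVertex a x 0 = r := by
    rw [hxW 0 (by omega)]
    rfl
  have x1 : candVertex a x 1 = hub := by
    rw [hxW 1 (by omega)]
    rfl
  refine ⟨x, hx, x0, fun v => ?_⟩
  rw [candParent, x0, x1]
  split_ifs with hvr
  · rw [show v = r from Fin.ext hvr, hp.root]
  · classical
    have key : ∀ k ≤ listLen a, iter (hub : ℕ) (fun j y => if candVertex a x (2 * j + 2) = v then
        candVertex a x (2 * j + 3) else y) k =
          (if ∃ j < k, e j = v then par v else hub : Fin n) := by
      intro k
      induction k with
      | zero => simp [iter]
      | succ k ih =>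
        intro hk
        rw [iter, ih (by omega), hxW (2 * k + 2) (by omega),
          hxW (2 * k + 3) (by omega), w2, w3]
        by_cases hkv : e k = v
        · rw [if_pos (by rw [hkv]), if_pos ⟨k, by omega, hkv⟩, hkv]
        · rw [if_neg fun h => hkv (Fin.ext h)]
          congr 1
          refine if_congr ⟨?_, ?_⟩ rfl rfl
          · rintro ⟨j, hj, hjv⟩
            exact ⟨j, by omega, hjv⟩
          · rintro ⟨j, hj, hjv⟩
            refine ⟨j, lt_of_le_of_ne (by omega) ?_, hjv⟩
            rintro rfl
            exact hkv hjv
    rw [key _ le_rfl]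
    split_ifs with hj
    · rfl
    · rw [hhub v fun hv => hj (heA v hv)]

/-- Some candidate describes an optimal tree. -/
theorem exists_optimal_candidate (hG : G.Connected) (hK : G.IsClique {v | v ∉ S}) :
    ∃ x < numCand (inputState G S), ∃ r par, Describes G S x r par ∧ IsParentMap G r par ∧
      treeCongestion G (parentGraph r par) = stc G := by
  classical
  obtain ⟨r, hub, par, A, hp, hopt, hA, hhub⟩ := exists_short_description hG hK
  let W : Finset (Fin n) := insert r (insert hub (A ∪ A.image par))
  have hW : #W ≤ numDigits (inputState G S) := by
    have h1 : #W ≤ _ := card_insert_le r (insert hub (A ∪ A.image par))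
    have h2 := card_insert_le hub (A ∪ A.image par)
    have h3 := card_union_le A (A.image par)
    have h4 : #(A.image par) ≤ #A := card_image_le
    rw [numDigits, listLen, sizeS_inputState]
    omega
  obtain ⟨σ, hσ, hσW⟩ := exists_automorphism hK (Q := pool G S)
    (fun u hu => by convert many_twins_in_pool hu) W hW
  obtain ⟨x, hx, hd⟩ := exists_describing (S := S) (A := A.image σ) (hub := σ hub) (hp.map σ hσ)
    (by
      rw [listLen, sizeS_inputState]
      exact card_image_le.trans hA)
    (fun v hv => by
      rw [hhub _ fun h => hv (mem_image.2 ⟨_, h, σ.apply_symm_apply v⟩)])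
    (hσW r (by simp [W])) (hσW hub (by simp [W]))
    (fun v hv => by
      obtain ⟨w, hw, rfl⟩ := mem_image.1 hv
      rw [Equiv.symm_apply_apply]
      exact ⟨hσW w (by simp [W, hw]),
        hσW (par w) (by
          simp only [W, mem_insert, mem_union]
          exact Or.inr (Or.inr (Or.inr (mem_image_of_mem par hw))))⟩)
  exact ⟨x, hx, _, _, hd, hp.map σ hσ, hp.map_optimal hopt σ hσ⟩

/-- A loop computing a minimum. -/
theorem iter_min_spec {F : ℕ → ℕ} {c N : ℕ} :
    (∀ x < N, iter c (fun x y => if F x < y then F x else y) N ≤ F x) ∧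
      (iter c (fun x y => if F x < y then F x else y) N = c ∨
        ∃ x < N, F x = iter c (fun x y => if F x < y then F x else y) N) := by
  induction N with
  | zero => simp [iter]
  | succ N ih =>
    rw [iter]
    split_ifs with h
    · refine ⟨fun x hx => ?_, Or.inr ⟨N, by omega, rfl⟩⟩
      rcases Nat.lt_succ_iff_lt_or_eq.1 hx with hx | rfl
      · exact h.le.trans (ih.1 x hx)
      · exact le_rfl
    · refine ⟨fun x hx => ?_, ih.2.imp_right fun ⟨x, hx, hx'⟩ => ⟨x, by omega, hx'⟩⟩
      rcases Nat.lt_succ_iff_lt_or_eq.1 hx with hx | rfl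
      · exact ih.1 x hx
      · exact not_lt.1 h

/-- A search loop returns a solution if there is one. -/
theorem iter_find_spec {p : ℕ → Prop} [DecidablePred p] {c N : ℕ} (h : ∃ x < N, p x) :
    p (iter c (fun x y => if p x then x else y) N) := by
  induction N with
  | zero => simp at h
  | succ N ih =>
    rw [iter]
    split_ifs with hN
    · exact hN
    · refine ih ?_
      obtain ⟨x, hx, hpx⟩ := h
      refine ⟨x, lt_of_le_of_ne (Nat.lt_succ_iff.1 hx) ?_, hpx⟩
      rintro rfl
      exact hN hpx

theorem bestCand_optimal (hG : G.Connected) (hK : G.IsClique {v | v ∉ S}) :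
    ∃ r par, Describes G S (bestCand (inputState G S)) r par ∧ IsParentMap G r par ∧
      treeCongestion G (parentGraph r par) = stc G := by
  classical
  have hn : 0 < n := by
    obtain ⟨v⟩ := hG.nonempty
    exact v.pos
  obtain ⟨x, hx, r₀, par₀, hd₀, hp₀, hopt₀⟩ := exists_optimal_candidate hG hK
  have hspec := iter_min_spec (F := candCost (inputState G S)) (c := n * n + 1)
    (N := numCand (inputState G S))
  change (∀ x < _, minCost (inputState G S) ≤ _) ∧ (minCost (inputState G S) = _ ∨
    ∃ x < _, _ = minCost (inputState G S)) at hspec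
  have hmin : minCost (inputState G S) ≤ stc G := by
    rw [← hopt₀, ← hd₀.cost_eq hp₀]
    exact hspec.1 x hx
  have hsq : stc G ≤ n * n := hopt₀ ▸ treeCongestion_le_sq hp₀
  have hbest : candCost (inputState G S) (bestCand (inputState G S)) =
      minCost (inputState G S) := by
    refine iter_find_spec (p := fun x => candCost (inputState G S) x = minCost (inputState G S))
      (hspec.2.resolve_left ?_)
    omega
  obtain ⟨r, par, hd⟩ := exists_describes (G := G) (S := S) hn (bestCand (inputState G S))
  have hp : IsParentMap G r par := by
    rw [← hd.valid_iff]
    by_contra hcon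
    rw [candCost, if_neg hcon, inputState_size] at hbest
    omega
  refine ⟨r, par, hd, hp, le_antisymm ?_ (stc_le hp.isSpanningTree)⟩
  rw [← hd.cost_eq hp, hbest]
  exact hmin

theorem output_eq {r : Fin n} {par : Fin n → Fin n}
    (hd : Describes G S (bestCand (inputState G S)) r par) (hp : IsParentMap G r par) (i : ℕ) :
    output (inputState G S) i = adjArray (parentGraph r par) i := by
  classical
  rw [output, adjArray, inputState_size, hd.1]
  refine if_congr ⟨?_, ?_⟩ rfl rfl
  · rintro ⟨u, hu, v, hv, hi, h⟩
    refine ⟨⟨u, hu⟩, ⟨v, hv⟩, by rw [hi, mul_comm], ?_⟩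
    rcases h with ⟨h1, h2⟩ | ⟨h1, h2⟩
    · have h3 : par ⟨u, hu⟩ = ⟨v, hv⟩ := Fin.ext ((hd.2 ⟨u, hu⟩).symm.trans h2)
      exact h3 ▸ hp.graph_adj fun e => h1 (congrArg Fin.val e)
    · have h3 : par ⟨v, hv⟩ = ⟨u, hu⟩ := Fin.ext ((hd.2 ⟨v, hv⟩).symm.trans h2)
      exact h3 ▸ (hp.graph_adj fun e => h1 (congrArg Fin.val e)).symm
  · rintro ⟨u, v, hi, _, h⟩
    refine ⟨u, u.2, v, v.2, by rw [hi, mul_comm], ?_⟩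
    rw [hd.2, hd.2]
    rcases h with ⟨h1, h2⟩ | ⟨h1, h2⟩
    · exact Or.inl ⟨fun e => h1 (Fin.ext e), congrArg Fin.val h2⟩
    · exact Or.inr ⟨fun e => h1 (Fin.ext e), congrArg Fin.val h2⟩

/-! ### The running time -/

/-- The pool has at most `#S + 2 ^ #S * D ≤ 2 ^ (3 * #S + 5)` elements, where
`D = 22 * #S ^ 2 + 24` is the length of a candidate; so there are `2 ^ O(#S ^ 3)` candidates. -/
theorem bound_le (G : SimpleGraph (Fin n)) (S : Finset (Fin n)) (hn : 0 < n) :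
    bound (inputState G S) + 1 ≤ n ^ 2 * 2 ^ (248 * #S ^ 3 + 122) := by
  have hp : poolSize (inputState G S) ≤ _ := poolSize_eq.trans_le card_pool_le
  have hD : numDigits (inputState G S) = 22 * (#S * #S) + 24 := by
    rw [numDigits, listLen, sizeS_inputState]
    ring
  rw [bound, numCand, inputState_size]
  generalize poolSize (inputState G S) = p at *
  generalize numDigits (inputState G S) = D at *
  generalize #S = q at *
  subst hD
  have hq : q + 1 ≤ 2 ^ q := Nat.lt_two_pow_self
  have hq2 : q ^ 2 ≤ q ^ 3 := by
    rcases Nat.eq_zero_or_pos q with rfl | h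
    · simp
    · exact Nat.pow_le_pow_right h (by norm_num)
  have hq1 : q ≤ q ^ 3 := Nat.le_self_pow (by norm_num) q
  have hqq : q * q + 1 ≤ 2 ^ q * 2 ^ q := by nlinarith
  have h1 : p ≤ 2 ^ (3 * q + 5) := by
    have e1 : 2 ^ (3 * q + 5) = 32 * (2 ^ q * 2 ^ q) * 2 ^ q := by
      rw [pow_add, pow_mul']
      ring
    rw [e1]
    calc p ≤ q + (22 * (q * q) + 24) * 2 ^ q := hp
      _ ≤ 2 ^ q + (22 * (q * q) + 24) * 2 ^ q := by gcongr; omega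
      _ = (22 * (q * q) + 25) * 2 ^ q := by ring
      _ ≤ _ := by gcongr; omega
  have h2 : p ^ (22 * (q * q) + 24) ≤ 2 ^ (248 * q ^ 3 + 120) := by
    calc _ ≤ (2 ^ (3 * q + 5)) ^ (22 * (q * q) + 24) := Nat.pow_le_pow_left h1 _
      _ = 2 ^ (66 * q ^ 3 + 110 * q ^ 2 + 72 * q + 120) := by
        rw [← pow_mul]
        congr 1
        ring
      _ ≤ _ := Nat.pow_le_pow_right (by norm_num) (by omega)
  have h3 : 22 * (q * q) + 75 ≤ 2 ^ (248 * q ^ 3 + 120) := by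
    calc 22 * (q * q) + 75 ≤ 248 * q ^ 3 + 120 := by
          rw [← sq]
          omega
      _ ≤ _ := Nat.lt_two_pow_self.le
  have h4 : 1 ≤ n ^ 2 := Nat.one_le_pow _ _ hn
  have e : 2 ^ (248 * q ^ 3 + 122) = 4 * 2 ^ (248 * q ^ 3 + 120) := by
    rw [show 248 * q ^ 3 + 122 = 248 * q ^ 3 + 120 + 2 by ring, pow_add]
    ring
  rw [e, ← sq n]
  generalize 2 ^ (248 * q ^ 3 + 120) = Y at *
  generalize p ^ (22 * (q * q) + 24) = X at *
  have h5 : n ^ 2 * 1 ≤ n ^ 2 * Y := Nat.mul_le_mul_left _ (by omega)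
  have h6 : 1 * Y ≤ n ^ 2 * Y := Nat.mul_le_mul_right _ h4
  have h7 : n ^ 2 * (4 * Y) = 4 * (n ^ 2 * Y) := by ring
  omega

end Input

theorem poly_bound_le {K b n q : ℕ} (hn : 0 < n) (hb : b + 1 ≤ n ^ 2 * 2 ^ (248 * q ^ 3 + 122)) :
    K * (b + 1) ^ K ≤ (K * 2 ^ (122 * K) + 248 * K) *
      2 ^ ((K * 2 ^ (122 * K) + 248 * K) * q ^ 3) * n ^ (K * 2 ^ (122 * K) + 248 * K) := by
  calc K * (b + 1) ^ K ≤ K * (n ^ 2 * 2 ^ (248 * q ^ 3 + 122)) ^ K := by gcongr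
    _ = K * 2 ^ (122 * K) * 2 ^ (248 * K * q ^ 3) * n ^ (2 * K) := by
      rw [mul_pow, ← pow_mul, ← pow_mul, show (248 * q ^ 3 + 122) * K = 122 * K + 248 * K * q ^ 3 by
        ring, pow_add]
      ring
    _ ≤ _ := by
      gcongr
      · omega
      · norm_num
      · omega
      · omega

end STC

theorem mainTheorem9 :
    ∃ (p : RAM.Prog) (c : ℕ),
      ∀ (n : ℕ) (G : SimpleGraph (Fin n)) (S : Finset (Fin n)),
        G.Connected → G.IsClique {v : Fin n | v ∉ S} →
          ∃ (t : ℕ) (s : RAM.State) (T : SimpleGraph (Fin n)),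
            RAM.Exec p (STC.inputState G S) t s ∧
            t ≤ c * 2 ^ (c * S.card ^ 3) * n ^ c ∧
            STC.Returns s T ∧
            STC.IsSpanningTree G T ∧
            STC.treeCongestion G T = STC.stc G := by
  obtain ⟨p, K, H⟩ := STC.exists_prog
  refine ⟨p, K * 2 ^ (122 * K) + 248 * K, fun n G S hG hK => ?_⟩
  have hn : 0 < n := by
    obtain ⟨v⟩ := hG.nonempty
    exact v.pos
  obtain ⟨t, s, hexec, ht, hout⟩ := H (STC.inputState G S)
  obtain ⟨r, par, hd, hp, hopt⟩ := STC.bestCand_optimal hG hK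
  exact ⟨t, s, STC.parentGraph r par, hexec,
    ht.trans (STC.poly_bound_le hn (STC.bound_le G S hn)),
    fun i hi => (hout i hi).trans (STC.output_eq hd hp i), hp.isSpanningTree, hopt⟩
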